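/- All graphs are finite and simple. For a connected graph $G$ on $n\ge 1$ vertices let $Q(G)=D(G)+A(G)$ be its signless Laplacian, where $D(G)$ is the diagonal matrix of vertex degrees and $A(G)$ the adjacency matrix; let $q_1(G)$ be the largest eigenvalue of $Q(G)$, let $\mathbf{x}$ be the unique positive unit eigenvector of $Q(G)$ for $q_1(G)$, and let $\gamma(G)=x_{\max}/x_{\min}$ be the ratio of the largest to the smallest entry of $\mathbf{x}$ (the principal ratio of $Q(G)$). For $r,s\ge 1$ the kite graph $P_r\cdot K_s$ is the graph on $r+s-1$ vertices obtained by identifying an end vertex of the path $P_r$ on $r$ vertices with a vertex of the complete graph $K_s$. (1) There is an $N$ such that for every $n\ge N$, every graph $G$ that maximizes $\gamma$ among all connected graphs on $n$ vertices is isomorphic to a kite graph $P_k\cdot K_{n-k+1}$ for some $1\le k\le n$. (2) If, for all sufficiently large $n$, the graph $G_n$ maximizes $\gamma$ among all connected graphs on $n$ vertices and $G_n$ is isomorphic to $P_{k_n}\cdot K_{n-k_n+1}$ with $1\le k_n\le n$, then $n-k_n=(1+o(1))\,\dfrac{n}{\log n}$ as $n\to\infty$, where $\log$ is the natural logarithm.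 -/

import Mathlib

open Filter Asymptotics

noncomputable section

open Classical in
/-- The signless Laplacian `Q(G) = D(G) + A(G)` of a finite simple graph, as a real matrix. -/
def signlessLaplacian {V : Type*} [Fintype V] [DecidableEq V] (G : SimpleGraph V) :
    Matrix V V ℝ :=
  G.degMatrix ℝ + G.adjMatrix ℝ

/-- The `Q`-spectral radius `q₁(G)`: the largest eigenvalue of `Q(G)`.
(The spectrum of the real symmetric matrix `Q(G)` is finite, and nonempty if `V` is.) -/
def qSpectralRadius {V : Type*} [Fintype V] [DecidableEq V] (G : SimpleGraph V) : ℝ :=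
  sSup (spectrum ℝ (signlessLaplacian G))

/-- `x` is a principal `Q`-eigenvector of `G`: a positive vector of Euclidean norm one that is an
eigenvector of `Q(G)` for `q₁(G)`. For connected `G` there is exactly one such vector. -/
structure IsPrincipalQEigenvector {V : Type*} [Fintype V] [DecidableEq V]
    (G : SimpleGraph V) (x : V → ℝ) : Prop where
  pos : ∀ v, 0 < x v
  unit : ∑ v, x v ^ 2 = 1
  eigen : Matrix.mulVec (signlessLaplacian G) x = qSpectralRadius G • x

open Classical in
/-- The principal ratio `γ(G) = x_max / x_min`, where `x` is the principal `Q`-eigenvector of `G`.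
The value is `0` by convention if there is no such vector, which is never the case for a connected
graph. -/
def principalRatio {V : Type*} [Fintype V] [DecidableEq V] (G : SimpleGraph V) : ℝ :=
  if h : ∃ x : V → ℝ, IsPrincipalQEigenvector G x then
    (⨆ v, h.choose v) / (⨅ v, h.choose v)
  else 0

/-- `G` maximizes the principal ratio among all connected graphs on its vertex set. -/
def MaximizesPrincipalRatio {V : Type*} [Fintype V] [DecidableEq V] (G : SimpleGraph V) : Prop :=
  G.Connected ∧ ∀ H : SimpleGraph V, H.Connected → principalRatio H ≤ principalRatio G

end

/-- The kite graph `P_r · K_s` (for `1 ≤ r` and `1 ≤ s`), on the vertices `0, 1, …, r + s - 2`: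
the vertices `0, …, r - 1` carry the path `P_r` with consecutive vertices adjacent, the vertices
`r - 1, …, r + s - 2` carry the complete graph `K_s`, and the two share exactly the vertex `r - 1`,
which is an end vertex of the path. -/
def kiteGraph (r s : ℕ) : SimpleGraph (Fin (r + s - 1)) where
  Adj i j :=
    ((i : ℕ) < r ∧ (j : ℕ) < r ∧ ((i : ℕ) + 1 = j ∨ (j : ℕ) + 1 = i)) ∨
      (i ≠ j ∧ r ≤ (i : ℕ) + 1 ∧ r ≤ (j : ℕ) + 1)
  symm := ⟨fun i j h => by
    rcases h with ⟨hi, hj, h⟩ | ⟨hne, hi, hj⟩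
    · exact Or.inl ⟨hj, hi, h.symm⟩
    · exact Or.inr ⟨hne.symm, hj, hi⟩⟩
  loopless := ⟨fun i h => by
    rcases h with ⟨_, _, h⟩ | ⟨hne, _, _⟩
    · omega
    · exact hne rfl⟩

/-! Scale the Perron vector `z` of a maximizer so that its largest entry is 1, and join a smallest
entry to a largest one by a shortest path `P 0, …, P l`, with `m` vertices off it. Geodesicity
leaves `P l` at most `m + 1` possible neighbours (the core), so `q ≤ 2(m + 1)`. Along any path the
entries grow at most as fast as on a pendant path (`pathGrowth`), and that growth increases with
`q`.

Two kites serve as competitors. The kite on the same path has a value above `2m`, and maximality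
forces `q` to be at least that value (`le_value`). Hence `P l` is joined to its whole core, and the
path is pendant up to its last few vertices. The kite whose path is one step shorter has a value
above `2(m + 1)`. Writing `D = 2(m + 1) - q` and `L = (l - 1) / (2(m + 1))`, it shows that the
entries where the path enters the core (the gate) sum to at most `exp(-D L)` (`sum_gate_decay` keeps
the quadratic truncation). But `D` is also the sum of `1 - z` over the core. The two facts together
leave a gate consisting of `P (l - 1)` alone, with a tiny entry (`card_gate`, `gate_entry_small`)
and no edge into the core (`not_adj_core`). So the graph lies inside the kite on its path, and
properly so would give too small a `q` (`lt_of_lt`).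

For the size, comparison with all kites shows that `M = m + 1` nearly maximizes `(n - M) log (2M)`.
With `M = c n / log n` this becomes `c - 1 ≤ log c` up to small errors, so `c` is near 1. This also
makes `L` large but much smaller than `m`, as the structural argument requires. -/

open Classical in
/-- `z` satisfies the eigenvalue equations of `Q(G)` for the value `q`. -/
def IsQEigen {V : Type*} [Fintype V] (G : SimpleGraph V) (q : ℝ) (z : V → ℝ) : Prop :=
  ∀ v, ∑ u with G.Adj v u, (z v + z u) = q * z v

/-! ### Existence of the positive eigenvector. -/

section Perron

variable {V : Type*} [Fintype V] [DecidableEq V]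

open Classical in
theorem signlessLaplacian_mulVec_apply (G : SimpleGraph V) (x : V → ℝ) (v : V) :
    (signlessLaplacian G).mulVec x v = ∑ u with G.Adj v u, (x v + x u) := by
  unfold signlessLaplacian SimpleGraph.degMatrix
  rw [Matrix.add_mulVec, Pi.add_apply, Matrix.mulVec_diagonal, SimpleGraph.adjMatrix_mulVec_apply,
    Finset.sum_add_distrib, Finset.sum_const, nsmul_eq_mul, ← SimpleGraph.card_neighborFinset_eq_degree]
  have : G.neighborFinset v = Finset.univ.filter (G.Adj v) := by ext; simp
  rw [this]

theorem IsPrincipalQEigenvector.isQEigen {G : SimpleGraph V} {x : V → ℝ}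
    (h : IsPrincipalQEigenvector G x) : IsQEigen G (qSpectralRadius G) x := by
  intro v
  have := congrFun h.eigen v
  rw [signlessLaplacian_mulVec_apply] at this
  exact this

theorem signlessLaplacian_isHermitian (G : SimpleGraph V) : (signlessLaplacian G).IsHermitian := by
  classical
  exact (G.isHermitian_degMatrix ℝ).add (G.isHermitian_adjMatrix ℝ)

theorem signlessLaplacian_nonneg (G : SimpleGraph V) (i j : V) : 0 ≤ signlessLaplacian G i j := by
  classical
  unfold signlessLaplacian SimpleGraph.degMatrix
  rw [Matrix.add_apply, Matrix.diagonal_apply, SimpleGraph.adjMatrix_apply]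
  split_ifs <;> positivity

/-- For a top eigenvector `w`, passing to `|w|` does not decrease the quadratic form of the
nonnegative matrix, so `|w|` is in the kernel of the semidefinite matrix `lam - A`. A zero entry of
`|w|` would spread along edges to the whole connected graph. -/
theorem exists_isPrincipalQEigenvector {G : SimpleGraph V} (hG : G.Connected) :
    ∃ x, IsPrincipalQEigenvector G x := by
  classical
  have hne : Nonempty V := hG.nonempty
  set A := signlessLaplacian G with hA
  have hH : A.IsHermitian := signlessLaplacian_isHermitian G
  set lam := qSpectralRadius G with hlam
  have hspec : spectrum ℝ A = Set.range hH.eigenvalues := hH.spectrum_real_eq_range_eigenvalues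
  have hfin : (spectrum ℝ A).Finite := by rw [hspec]; exact Set.finite_range _
  have hnon : (spectrum ℝ A).Nonempty := by rw [hspec]; exact Set.range_nonempty _
  have hmem : lam ∈ spectrum ℝ A := hnon.csSup_mem hfin
  have hpsd : (algebraMap ℝ (Matrix V V ℝ) lam - A).PosSemidef := by
    have hH2 : (algebraMap ℝ (Matrix V V ℝ) lam - A).IsHermitian := by
      refine Matrix.IsHermitian.sub ?_ hH
      rw [Matrix.algebraMap_eq_diagonal]
      exact Matrix.isHermitian_diagonal _
    rw [hH2.posSemidef_iff_eigenvalues_nonneg]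
    intro i
    have h1 : hH2.eigenvalues i ∈ spectrum ℝ (algebraMap ℝ (Matrix V V ℝ) lam - A) := by
      rw [hH2.spectrum_real_eq_range_eigenvalues]; exact Set.mem_range_self i
    rw [← spectrum.singleton_sub_eq] at h1
    obtain ⟨a, ha, b, hb, hab⟩ := h1
    rw [Set.mem_singleton_iff] at ha
    have : b ≤ lam := le_csSup hfin.bddAbove hb
    simp only [Pi.zero_apply]
    rw [← hab, ha]
    simpa using this
  obtain ⟨i, hi⟩ : ∃ i, hH.eigenvalues i = lam := by rw [hspec] at hmem; exact hmem
  set w : V → ℝ := (hH.eigenvectorBasis i).ofLp with hw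
  have hwA : A.mulVec w = lam • w := by rw [← hi]; exact hH.mulVec_eigenvectorBasis i
  have hwn : ∑ v, w v ^ 2 = 1 := by
    have := (hH.eigenvectorBasis.orthonormal).1 i
    rw [EuclideanSpace.norm_eq, Real.sqrt_eq_one] at this
    simpa using this
  set x : V → ℝ := fun v => |w v| with hx
  have hxn : ∑ v, x v ^ 2 = 1 := by simpa [hx] using hwn
  have hquad : ∀ y : V → ℝ, y ⬝ᵥ ((algebraMap ℝ (Matrix V V ℝ) lam - A).mulVec y)
      = lam * ∑ v, y v ^ 2 - ∑ v, ∑ u, y v * (A v u * y u) := by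
    intro y
    rw [Matrix.sub_mulVec, dotProduct_sub, Matrix.algebraMap_eq_diagonal]
    congr 1
    · simp only [dotProduct, Matrix.mulVec_diagonal, Finset.mul_sum]
      refine Finset.sum_congr rfl fun v _ => ?_
      simp only [Pi.algebraMap_apply, Algebra.algebraMap_self, RingHom.id_apply]
      ring
    · simp only [dotProduct, Matrix.mulVec, Finset.mul_sum]
  have hw0 : w ⬝ᵥ ((algebraMap ℝ (Matrix V V ℝ) lam - A).mulVec w) = 0 := by
    rw [Matrix.sub_mulVec, hwA, Matrix.algebraMap_eq_diagonal]
    have : (Matrix.diagonal (algebraMap ℝ (V → ℝ) lam)).mulVec w = lam • w := by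
      ext v; simp [Matrix.mulVec_diagonal]
    rw [this, sub_self, dotProduct_zero]
  have hx0 : x ⬝ᵥ ((algebraMap ℝ (Matrix V V ℝ) lam - A).mulVec x) = 0 := by
    apply le_antisymm
    · rw [← hw0, hquad, hquad, hxn, hwn]
      refine sub_le_sub_left (Finset.sum_le_sum fun v _ => Finset.sum_le_sum fun u _ => ?_) _
      have : x v * (A v u * x u) = |w v * (A v u * w u)| := by
        rw [abs_mul, abs_mul, abs_of_nonneg (signlessLaplacian_nonneg G v u)]
      rw [this]
      exact le_abs_self _
    · exact hpsd.dotProduct_mulVec_nonneg x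
  have hxA : A.mulVec x = lam • x := by
    have := (hpsd.dotProduct_mulVec_zero_iff x).1 hx0
    rw [Matrix.sub_mulVec, sub_eq_zero] at this
    rw [← this]
    ext v; simp [Matrix.algebraMap_eq_diagonal, Matrix.mulVec_diagonal]
  refine ⟨x, ?_, hxn, hxA⟩
  have hnn : ∀ v, 0 ≤ x v := fun v => abs_nonneg _
  have hstep : ∀ v u, x v = 0 → G.Adj v u → x u = 0 := by
    intro v u hv huv
    have h1 := congrFun hxA v
    rw [hA, signlessLaplacian_mulVec_apply] at h1
    simp only [Pi.smul_apply, smul_eq_mul, hv, mul_zero, zero_add] at h1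
    exact (Finset.sum_eq_zero_iff_of_nonneg fun a _ => hnn a).1 h1 u (by simpa using huv)
  intro v
  refine lt_of_le_of_ne (hnn v) fun h0 => ?_
  have hall : ∀ u, x u = 0 := by
    intro u
    obtain ⟨p⟩ := hG.preconnected v u
    have : ∀ {a b : V} (_ : G.Walk a b), x a = 0 → x b = 0 := by
      intro a b p
      induction p with
      | nil => exact id
      | cons h _ ih => exact fun ha => ih (hstep _ _ ha h)
    exact this p h0.symm
  simp [hall] at hxn

/-- The value of `principalRatio` for a connected graph is attained by a positive eigenvector. -/
theorem exists_isQEigen_principalRatio {G : SimpleGraph V} (hG : G.Connected) :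
    ∃ (z : V → ℝ) (a b : V), (∀ v, 0 < z v) ∧ (∀ v, z v ≤ 1) ∧ z b = 1 ∧ (∀ v, z a ≤ z v) ∧
      IsQEigen G (qSpectralRadius G) z ∧ principalRatio G = 1 / z a := by
  classical
  have hne : Nonempty V := hG.nonempty
  have hex := exists_isPrincipalQEigenvector hG
  set x := hex.choose with hx
  have hxp : IsPrincipalQEigenvector G x := hex.choose_spec
  obtain ⟨b, hb⟩ := Finite.exists_max x
  obtain ⟨a, ha⟩ := Finite.exists_min x
  have hb0 := hxp.pos b
  have hsup : (⨆ v, x v) = x b :=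
    le_antisymm (ciSup_le hb) (le_ciSup (Set.finite_range x).bddAbove b)
  have hinf : (⨅ v, x v) = x a :=
    le_antisymm (ciInf_le (Set.finite_range x).bddBelow a) (le_ciInf ha)
  refine ⟨fun v => x v / x b, a, b, fun v => div_pos (hxp.pos v) hb0,
    fun v => (div_le_one hb0).2 (hb v), div_self hb0.ne', fun v => div_le_div_of_nonneg_right (ha v) hb0.le, ?_, ?_⟩
  · intro v
    have := hxp.isQEigen v
    simp only [← add_div]
    rw [← Finset.sum_div, this, mul_div_assoc]
  · rw [principalRatio, dif_pos hex, ← hx, hsup, hinf, one_div_div]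

end Perron

/-! ### Growth along a pendant path and its dependence on `q`. -/

/-- The growth of a `Q`-eigenvector along a pendant path, starting with the value `1` at its end. -/
def pathGrowth (q : ℝ) : ℕ → ℝ
  | 0 => 1
  | 1 => q - 1
  | j + 2 => (q - 2) * pathGrowth q (j + 1) - pathGrowth q j

theorem pathGrowth_pos_and_step {q : ℝ} (hq : 4 ≤ q) (j : ℕ) :
    0 < pathGrowth q j ∧ (q - 3) * pathGrowth q j ≤ pathGrowth q (j + 1) := by
  induction j with
  | zero => simp only [pathGrowth]; constructor <;> linarith
  | succ j ih =>
    obtain ⟨h1, h2⟩ := ih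
    have h3 : pathGrowth q j ≤ pathGrowth q (j + 1) := by nlinarith
    refine ⟨by linarith, ?_⟩
    rw [pathGrowth]; linarith

theorem pathGrowth_pos {q : ℝ} (hq : 4 ≤ q) (j : ℕ) : 0 < pathGrowth q j :=
  (pathGrowth_pos_and_step hq j).1

theorem pathGrowth_step {q : ℝ} (hq : 4 ≤ q) (j : ℕ) :
    (q - 3) * pathGrowth q j ≤ pathGrowth q (j + 1) :=
  (pathGrowth_pos_and_step hq j).2

theorem pow_le_pathGrowth {q : ℝ} (hq : 4 ≤ q) (j : ℕ) : (q - 3) ^ j ≤ pathGrowth q j := by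
  induction j with
  | zero => simp [pathGrowth]
  | succ j ih =>
    refine le_trans ?_ (pathGrowth_step hq j)
    rw [pow_succ']
    exact mul_le_mul_of_nonneg_left ih (by linarith)

/-- The ratio of consecutive values of `pathGrowth`. -/
noncomputable def pathRatio (q : ℝ) (j : ℕ) : ℝ := pathGrowth q (j + 1) / pathGrowth q j

theorem pathGrowth_succ {q : ℝ} (hq : 4 ≤ q) (j : ℕ) :
    pathGrowth q (j + 1) = pathRatio q j * pathGrowth q j := by
  rw [pathRatio, div_mul_cancel₀ _ (pathGrowth_pos hq j).ne']

theorem pathRatio_zero (q : ℝ) : pathRatio q 0 = q - 1 := by simp [pathRatio, pathGrowth]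

theorem pathRatio_succ {q : ℝ} (hq : 4 ≤ q) (j : ℕ) :
    pathRatio q (j + 1) = q - 2 - 1 / pathRatio q j := by
  have h1 := pathGrowth_pos hq j
  have h2 := pathGrowth_pos hq (j + 1)
  rw [pathRatio, pathRatio, pathGrowth, one_div_div]
  field_simp

theorem le_pathRatio {q : ℝ} (hq : 4 ≤ q) (j : ℕ) : q - 3 ≤ pathRatio q j := by
  rw [pathRatio, le_div_iff₀ (pathGrowth_pos hq j)]
  exact pathGrowth_step hq j

theorem pathRatio_pos {q : ℝ} (hq : 4 ≤ q) (j : ℕ) : 0 < pathRatio q j := by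
  linarith [le_pathRatio hq j]

theorem pathRatio_le {q : ℝ} (hq : 4 ≤ q) (j : ℕ) : pathRatio q j ≤ q := by
  cases j with
  | zero => rw [pathRatio_zero]; linarith
  | succ j =>
    rw [pathRatio_succ hq]
    have := one_div_pos.2 (pathRatio_pos hq j)
    linarith

/-- In the recursion `ρ ↦ q - 2 - 1/ρ` the feedback term is increasing in `ρ`, so each ratio grows
with slope at least 1 in `q`. The companion bound below has slope at most 2, because the ratios are
at least 2. -/
theorem add_le_pathRatio {q q' : ℝ} (hq : 4 ≤ q) (h : q ≤ q') (j : ℕ) :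
    pathRatio q j + (q' - q) ≤ pathRatio q' j := by
  induction j with
  | zero => rw [pathRatio_zero, pathRatio_zero]; linarith
  | succ j ih =>
    rw [pathRatio_succ hq, pathRatio_succ (hq.trans h)]
    have : 1 / pathRatio q' j ≤ 1 / pathRatio q j :=
      one_div_le_one_div_of_le (pathRatio_pos hq j) (by linarith)
    linarith

theorem pathRatio_le_add {q q' : ℝ} (hq : 5 ≤ q) (h : q ≤ q') (j : ℕ) :
    pathRatio q' j ≤ pathRatio q j + 2 * (q' - q) := by
  have hq4 : 4 ≤ q := by linarith
  induction j with
  | zero => rw [pathRatio_zero, pathRatio_zero]; linarith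
  | succ j ih =>
    rw [pathRatio_succ hq4, pathRatio_succ (hq4.trans h)]
    have h1 := le_pathRatio hq4 j
    have h2 := le_pathRatio (hq4.trans h) j
    have h3 : 1 / pathRatio q j - 1 / pathRatio q' j ≤ q' - q := by
      rw [div_sub_div _ _ (by linarith) (by linarith), div_le_iff₀ (by nlinarith)]
      have : 4 ≤ pathRatio q j * pathRatio q' j := by nlinarith
      nlinarith
    linarith

theorem pow_mul_pathGrowth_le {q q' : ℝ} (hq : 4 ≤ q) (h : q ≤ q') (j : ℕ) :
    (q' / q) ^ j * pathGrowth q j ≤ pathGrowth q' j := by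
  induction j with
  | zero => simp [pathGrowth]
  | succ j ih =>
    rw [pathGrowth_succ hq, pathGrowth_succ (hq.trans h)]
    have h1 : q' / q * pathRatio q j ≤ pathRatio q' j := by
      refine le_trans ?_ (add_le_pathRatio hq h j)
      rw [div_mul_eq_mul_div, div_le_iff₀ (by linarith)]
      nlinarith [pathRatio_le hq j]
    calc (q' / q) ^ (j + 1) * (pathRatio q j * pathGrowth q j)
        = (q' / q * pathRatio q j) * ((q' / q) ^ j * pathGrowth q j) := by ring
      _ ≤ pathRatio q' j * pathGrowth q' j := by
        have := pathGrowth_pos hq j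
        have := (pathRatio_pos (hq.trans h) j).le
        have : 0 < q' / q := div_pos (by linarith) (by linarith)
        exact mul_le_mul h1 ih (by positivity) (by positivity)

theorem pathGrowth_le_pow_mul {q q' : ℝ} (hq : 5 ≤ q) (h : q ≤ q') (j : ℕ) :
    pathGrowth q' j ≤ (1 + 2 * (q' - q) / (q - 3)) ^ j * pathGrowth q j := by
  have hq4 : 4 ≤ q := by linarith
  induction j with
  | zero => simp [pathGrowth]
  | succ j ih =>
    rw [pathGrowth_succ hq4, pathGrowth_succ (hq4.trans h)]
    have h0 : 0 ≤ 2 * (q' - q) / (q - 3) := div_nonneg (by linarith) (by linarith)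
    have h1 : pathRatio q' j ≤ (1 + 2 * (q' - q) / (q - 3)) * pathRatio q j := by
      refine (pathRatio_le_add hq h j).trans ?_
      have h2 := le_pathRatio hq4 j
      have h3 : 2 * (q' - q) / (q - 3) * (q - 3) = 2 * (q' - q) :=
        div_mul_cancel₀ _ (by linarith)
      nlinarith
    have h4 := (pathGrowth_pos hq4 j).le
    have h5 := (pathRatio_pos hq4 j).le
    calc pathRatio q' j * pathGrowth q' j
        ≤ ((1 + 2 * (q' - q) / (q - 3)) * pathRatio q j) *
          ((1 + 2 * (q' - q) / (q - 3)) ^ j * pathGrowth q j) :=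
          mul_le_mul h1 ih (pathGrowth_pos (hq4.trans h) j).le (by positivity)
      _ = _ := by ring

theorem pathGrowth_mono {q q' : ℝ} (hq : 4 ≤ q) (h : q ≤ q') (j : ℕ) :
    pathGrowth q j ≤ pathGrowth q' j := by
  refine le_trans ?_ (pow_mul_pathGrowth_le hq h j)
  refine le_mul_of_one_le_left (pathGrowth_pos hq j).le (one_le_pow₀ ?_)
  rwa [one_le_div (by linarith)]

theorem pathGrowth_strictMono {q q' : ℝ} (hq : 4 ≤ q) (h : q < q') {j : ℕ} (hj : 1 ≤ j) :
    pathGrowth q j < pathGrowth q' j := by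
  refine lt_of_lt_of_le ?_ (pow_mul_pathGrowth_le hq h.le j)
  refine lt_mul_of_one_lt_left (pathGrowth_pos hq j) (one_lt_pow₀ ?_ (by omega))
  rwa [one_lt_div (by linarith)]

/-! ### Comparison principles for positive eigenvectors. -/

section Eigen

variable {V : Type*} [Fintype V] {G : SimpleGraph V} {q : ℝ} {z : V → ℝ}

theorem IsQEigen.sum_le (h : IsQEigen G q z) (hz : ∀ v, 0 < z v) {v : V} {S : Finset V}
    (hS : ∀ u ∈ S, G.Adj v u) : ∑ u ∈ S, (z v + z u) ≤ q * z v := by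
  classical
  rw [← h v]
  refine Finset.sum_le_sum_of_subset_of_nonneg (fun u hu => by simpa using hS u hu) ?_
  intro u _ _
  have := hz u; have := hz v
  positivity

theorem IsQEigen.sum_eq (h : IsQEigen G q z) {v : V} {S : Finset V}
    (hS : ∀ u, G.Adj v u ↔ u ∈ S) : ∑ u ∈ S, (z v + z u) = q * z v := by
  classical
  rw [← h v]
  refine Finset.sum_congr ?_ fun _ _ => rfl
  ext u; simp [hS]

theorem IsQEigen.add_le (h : IsQEigen G q z) (hz : ∀ v, 0 < z v) {v u : V} (huv : G.Adj v u) :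
    z v + z u ≤ q * z v := by
  classical
  have := h.sum_le hz (v := v) (S := {u}) (by simpa using huv)
  simpa using this

/-- Further neighbours of the path vertices only add positive terms, so the pendant recursion
survives as an inequality. The induction is on consecutive ratios. -/
theorem IsQEigen.le_pathGrowth (h : IsQEigen G q z) (hz : ∀ v, 0 < z v) (hq : 4 ≤ q) {P : ℕ → V}
    {l : ℕ} (hP : ∀ i < l, G.Adj (P i) (P (i + 1)))
    (hinj : ∀ i ≤ l, ∀ j ≤ l, P i = P j → i = j) :
    ∀ j ≤ l, z (P j) ≤ pathGrowth q j * z (P 0) := by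
  classical
  have hr : ∀ j, j < l → z (P (j + 1)) * pathGrowth q j ≤ z (P j) * pathGrowth q (j + 1) := by
    intro j
    induction j with
    | zero =>
      intro hj
      have := h.add_le hz (hP 0 hj)
      simp only [pathGrowth]; linarith
    | succ j ih =>
      intro hj
      have h1 := ih (by omega)
      have h2 := h.sum_le hz (v := P (j + 1)) (S := {P j, P (j + 2)}) (by
        intro u hu
        simp only [Finset.mem_insert, Finset.mem_singleton] at hu
        rcases hu with rfl | rfl
        · exact (hP j (by omega)).symm
        · exact hP (j + 1) hj)
      rw [Finset.sum_pair (fun h => by have := hinj _ (by omega) _ (by omega) h; omega)] at h2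
      have h3 := pathGrowth_pos hq (j + 1)
      rw [pathGrowth]
      nlinarith
  intro j
  induction j with
  | zero => intro _; simp [pathGrowth]
  | succ j ih =>
    intro hj
    have h1 := hr j hj
    have h2 := ih (by omega)
    have h3 := pathGrowth_pos hq j
    have h4 := pathGrowth_pos hq (j + 1)
    have : z (P (j + 1)) * pathGrowth q j ≤ pathGrowth q (j + 1) * z (P 0) * pathGrowth q j := by
      nlinarith
    exact le_of_mul_le_mul_right this h3

theorem IsQEigen.eq_pathGrowth (h : IsQEigen G q z) {P : ℕ → V} {l : ℕ}
    (hinj : ∀ i ≤ l, ∀ j ≤ l, P i = P j → i = j)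
    (h0 : 0 < l → ∀ u, G.Adj (P 0) u ↔ u = P 1)
    (hi : ∀ i, i + 1 < l → ∀ u, G.Adj (P (i + 1)) u ↔ u = P i ∨ u = P (i + 2)) :
    ∀ j ≤ l, z (P j) = pathGrowth q j * z (P 0) := by
  classical
  intro j
  induction j using Nat.strong_induction_on with
  | _ j ih =>
    match j with
    | 0 => intro _; simp [pathGrowth]
    | 1 =>
      intro hl
      have := h.sum_eq (v := P 0) (S := {P 1}) (by simpa using h0 hl)
      rw [Finset.sum_singleton] at this
      rw [pathGrowth]; linarith
    | j + 2 =>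
      intro hl
      have h1 := h.sum_eq (v := P (j + 1)) (S := {P j, P (j + 2)}) (by simpa using hi j hl)
      rw [Finset.sum_pair (fun h => by have := hinj _ (by omega) _ (by omega) h; omega)] at h1
      have h2 := ih j (by omega) (by omega)
      have h3 := ih (j + 1) (by omega) (by omega)
      rw [pathGrowth]
      linear_combination h1 - h2 + (q - 2) * h3

/-- Crude substitute for `le_pathGrowth` that needs no lower bound of 4 on `q`. -/
theorem IsQEigen.le_pow (h : IsQEigen G q z) (hz : ∀ v, 0 < z v) (hq : 0 ≤ q) {P : ℕ → V}
    {l : ℕ} (hP : ∀ i < l, G.Adj (P i) (P (i + 1))) :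
    ∀ j ≤ l, z (P j) ≤ q ^ j * z (P 0) := by
  intro j
  induction j with
  | zero => intro _; simp
  | succ j ih =>
    intro hj
    have h1 := h.add_le hz (hP j hj)
    have h2 := ih (by omega)
    have h3 := hz (P j)
    calc z (P (j + 1)) ≤ q * z (P j) := by linarith
      _ ≤ q * (q ^ j * z (P 0)) := mul_le_mul_of_nonneg_left h2 hq
      _ = _ := by ring

/-- Read the equation at the smallest entry on the clique. -/
theorem IsQEigen.clique_le (h : IsQEigen G q z) (hz : ∀ v, 0 < z v) {S : Finset V} {s : ℕ}
    (hs : S.card = s + 1) (hS : ∀ u ∈ S, ∀ v ∈ S, u ≠ v → G.Adj u v) : 2 * (s : ℝ) ≤ q := by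
  classical
  obtain ⟨v, hv, hmin⟩ := S.exists_min_image z (Finset.card_pos.1 (by omega))
  have h1 := h.sum_le hz (v := v) (S := S.erase v) (fun u hu => by
    rw [Finset.mem_erase] at hu
    exact hS v hv u hu.2 hu.1.symm)
  have h2 : ∑ u ∈ S.erase v, (z v + z v) ≤ ∑ u ∈ S.erase v, (z v + z u) :=
    Finset.sum_le_sum fun u hu => by
      have := hmin u (Finset.mem_of_mem_erase hu)
      linarith
  rw [Finset.sum_const, Finset.card_erase_of_mem hv, hs, nsmul_eq_mul] at h2
  have h3 := hz v
  simp only [Nat.add_sub_cancel] at h2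
  nlinarith

/-- Equality in `clique_le` would make `z` constant on the clique, so `b` would also be a minimum
there; its extra neighbour `c` then contributes a positive surplus. -/
theorem IsQEigen.clique_lt (h : IsQEigen G q z) (hz : ∀ v, 0 < z v) {S : Finset V} {s : ℕ}
    (hs : S.card = s + 1) (hS : ∀ u ∈ S, ∀ v ∈ S, u ≠ v → G.Adj u v) {b c : V} (hb : b ∈ S)
    (hc : c ∉ S) (hbc : G.Adj b c) : 2 * (s : ℝ) < q := by
  classical
  by_contra! hcon
  have key : ∀ v ∈ S, (∀ u ∈ S, z v ≤ z u) → v ≠ b ∧ ∀ u ∈ S, z u = z v := by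
    intro v hv hmin
    have h2 : ∑ u ∈ S.erase v, (z v + z v) ≤ ∑ u ∈ S.erase v, (z v + z u) :=
      Finset.sum_le_sum fun u hu => by
        have := hmin u (Finset.mem_of_mem_erase hu)
        linarith
    have h3 := hz v
    have h4 : ∑ u ∈ S.erase v, (z v + z v) = 2 * s * z v := by
      rw [Finset.sum_const, Finset.card_erase_of_mem hv, hs, nsmul_eq_mul, Nat.add_sub_cancel]
      ring
    constructor
    · rintro rfl
      have h1 := h.sum_le hz (v := v) (S := insert c (S.erase v)) (fun u hu => by
        rw [Finset.mem_insert, Finset.mem_erase] at hu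
        rcases hu with rfl | hu
        · exact hbc
        · exact hS v hv u hu.2 hu.1.symm)
      rw [Finset.sum_insert (by simp [hc])] at h1
      have := hz c
      nlinarith
    · have h1 := h.sum_le hz (v := v) (S := S.erase v) (fun u hu => by
        rw [Finset.mem_erase] at hu
        exact hS v hv u hu.2 hu.1.symm)
      have h5 : ∑ u ∈ S.erase v, (z v + z v) = ∑ u ∈ S.erase v, (z v + z u) := by
        refine le_antisymm h2 ?_
        rw [h4]; nlinarith
      rw [Finset.sum_eq_sum_iff_of_le fun u hu => by
        have := hmin u (Finset.mem_of_mem_erase hu)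
        linarith] at h5
      intro u hu
      by_cases huv : u = v
      · rw [huv]
      · have := h5 u (Finset.mem_erase.2 ⟨huv, hu⟩)
        linarith
  obtain ⟨v, hv, hmin⟩ := S.exists_min_image z ⟨b, hb⟩
  obtain ⟨-, h1⟩ := key v hv hmin
  exact (key b hb fun u hu => (h1 b hb).trans_le (hmin u hu)).1 rfl

/-- Pair the two positive eigenvectors: by symmetry `q ⟨y, z⟩ = ⟨Q(G) y, z⟩`, and an additional edge
of `K` makes this smaller than `⟨Q(K) y, z⟩ = q' ⟨y, z⟩`. -/
theorem IsQEigen.lt_of_lt {K : SimpleGraph V} {q' : ℝ} {y : V → ℝ} (h : IsQEigen G q z)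
    (hz : ∀ v, 0 < z v) (h' : IsQEigen K q' y) (hy : ∀ v, 0 < y v) (hGK : G < K) : q < q' := by
  classical
  obtain ⟨hle, hnot⟩ := lt_iff_le_not_ge.1 hGK
  have hbil : ∑ v, y v * ∑ u with G.Adj v u, (z v + z u)
      = ∑ v, z v * ∑ u with G.Adj v u, (y v + y u) := by
    simp only [Finset.mul_sum, mul_add, Finset.sum_add_distrib]
    congr 1
    · exact Finset.sum_congr rfl fun v _ => Finset.sum_congr rfl fun u _ => mul_comm _ _
    · simp only [Finset.sum_filter]
      rw [Finset.sum_comm]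
      refine Finset.sum_congr rfl fun v _ => Finset.sum_congr rfl fun u _ => ?_
      simp only [G.adj_comm u v, mul_comm (y u)]
  have hmono : ∀ v, ∑ u with G.Adj v u, (y v + y u) ≤ ∑ u with K.Adj v u, (y v + y u) := by
    intro v
    rw [h' v]
    exact h'.sum_le hy (fun u hu => hle (by simpa using hu))
  obtain ⟨a, b, hab, hnab⟩ : ∃ a b, K.Adj a b ∧ ¬ G.Adj a b := by
    by_contra! hcon
    exact hnot fun a b hab => hcon a b hab
  have hlt : ∑ v, z v * ∑ u with G.Adj v u, (y v + y u)
      < ∑ v, z v * ∑ u with K.Adj v u, (y v + y u) := by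
    refine Finset.sum_lt_sum (fun v _ => mul_le_mul_of_nonneg_left (hmono v) (hz v).le)
      ⟨a, Finset.mem_univ _, mul_lt_mul_of_pos_left ?_ (hz a)⟩
    refine Finset.sum_lt_sum_of_subset (i := b) ?_ (by simpa using hab) (by simpa using hnab)
      (by have := hy a; have := hy b; positivity)
      (fun u _ _ => by have := hy a; have := hy u; positivity)
    intro u hu
    simp only [Finset.mem_filter, Finset.mem_univ, true_and] at hu ⊢
    exact hle hu
  rw [← hbil] at hlt
  have e1 : ∑ v, y v * ∑ u with G.Adj v u, (z v + z u) = q * ∑ v, y v * z v := by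
    rw [Finset.mul_sum]
    refine Finset.sum_congr rfl fun v _ => ?_
    rw [h v]; ring
  have e2 : ∑ v, z v * ∑ u with K.Adj v u, (y v + y u) = q' * ∑ v, y v * z v := by
    rw [Finset.mul_sum]
    refine Finset.sum_congr rfl fun v _ => ?_
    rw [h' v]; ring
  rw [e1, e2] at hlt
  exact lt_of_mul_lt_mul_right hlt
    (Finset.sum_nonneg fun v _ => (mul_pos (hy v) (hz v)).le)

end Eigen

/-! ### Kites along a prescribed path, used as competitors. -/

section Kite

variable {V : Type*}

/-- The kite graph on the vertex set `V` whose path is `P 0, …, P l` and whose clique consists of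
all vertices other than `P 0, …, P (l - 1)`. -/
def kiteAlong (P : ℕ → V) (l : ℕ) : SimpleGraph V where
  Adj u v := u ≠ v ∧ ((∃ i < l, (u = P i ∧ v = P (i + 1)) ∨ (v = P i ∧ u = P (i + 1))) ∨
    ((∀ i < l, u ≠ P i) ∧ ∀ i < l, v ≠ P i))
  symm := ⟨fun u v h => by
    obtain ⟨hne, ⟨i, hi, h⟩ | h⟩ := h
    · exact ⟨hne.symm, Or.inl ⟨i, hi, h.symm⟩⟩
    · exact ⟨hne.symm, Or.inr h.symm⟩⟩
  loopless := ⟨fun u h => h.1 rfl⟩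

variable {P : ℕ → V} {l : ℕ}

theorem kiteAlong_adj_path (hinj : ∀ i ≤ l, ∀ j ≤ l, P i = P j → i = j) {i : ℕ} (hi : i < l) :
    (kiteAlong P l).Adj (P i) (P (i + 1)) :=
  ⟨fun h => by have := hinj _ (by omega) _ (by omega) h; omega,
    Or.inl ⟨i, hi, Or.inl ⟨rfl, rfl⟩⟩⟩

theorem kiteAlong_adj_clique {u v : V} (huv : u ≠ v) (hu : ∀ i < l, u ≠ P i)
    (hv : ∀ i < l, v ≠ P i) : (kiteAlong P l).Adj u v :=
  ⟨huv, Or.inr ⟨hu, hv⟩⟩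

theorem kiteAlong_adj_start (hinj : ∀ i ≤ l, ∀ j ≤ l, P i = P j → i = j) (hl : 0 < l) (u : V) :
    (kiteAlong P l).Adj (P 0) u ↔ u = P 1 := by
  constructor
  · rintro ⟨_, ⟨i, hi, ⟨h1, h2⟩ | ⟨h1, h2⟩⟩ | ⟨h, -⟩⟩
    · have := hinj _ (by omega) _ (by omega) h1; subst this; exact h2
    · have := hinj _ (by omega) _ (by omega) h2; omega
    · exact absurd rfl (h 0 hl)
  · rintro rfl; exact kiteAlong_adj_path hinj hl

theorem kiteAlong_adj_mid (hinj : ∀ i ≤ l, ∀ j ≤ l, P i = P j → i = j) (i : ℕ) (hi : i + 1 < l)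
    (u : V) : (kiteAlong P l).Adj (P (i + 1)) u ↔ u = P i ∨ u = P (i + 2) := by
  constructor
  · rintro ⟨_, ⟨j, hj, ⟨h1, h2⟩ | ⟨h1, h2⟩⟩ | ⟨h, -⟩⟩
    · have := hinj _ (by omega) _ (by omega) h1; subst this; exact Or.inr h2
    · have := hinj _ (by omega) _ (by omega) h2
      obtain rfl : i = j := by omega
      exact Or.inl h1
    · exact absurd rfl (h _ hi)
  · rintro (rfl | rfl)
    · exact (kiteAlong_adj_path hinj (by omega)).symm
    · exact kiteAlong_adj_path hinj hi

theorem kiteAlong_connected (hinj : ∀ i ≤ l, ∀ j ≤ l, P i = P j → i = j) :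
    (kiteAlong P l).Connected := by
  have hpath : ∀ j ≤ l, (kiteAlong P l).Reachable (P (l - j)) (P l) := by
    intro j
    induction j with
    | zero => intro _; exact SimpleGraph.Reachable.refl _
    | succ j ih =>
      intro hj
      refine SimpleGraph.Reachable.trans (SimpleGraph.Adj.reachable ?_) (ih (by omega))
      have := kiteAlong_adj_path hinj (i := l - (j + 1)) (by omega)
      rwa [show l - (j + 1) + 1 = l - j by omega] at this
  have hall : ∀ v, (kiteAlong P l).Reachable v (P l) := by
    intro v
    by_cases hv : ∃ i < l, v = P i
    · obtain ⟨i, hi, rfl⟩ := hv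
      have := hpath (l - i) (by omega)
      rwa [show l - (l - i) = i by omega] at this
    · push Not at hv
      by_cases hvl : v = P l
      · rw [hvl]
      · exact (kiteAlong_adj_clique hvl hv fun i hi h => by
          have := hinj _ le_rfl _ hi.le h; omega).reachable
  have : Nonempty V := ⟨P 0⟩
  exact ⟨fun u v => (hall u).trans (hall v).symm⟩

theorem card_off_path [Fintype V] [DecidableEq V] (hinj : ∀ i ≤ l, ∀ j ≤ l, P i = P j → i = j)
    {t m : ℕ} (ht : t ≤ l + 1) (hcard : Fintype.card V = t + m) :
    (Finset.univ \ (Finset.range t).image P).card = m := by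
  rw [Finset.card_sdiff_of_subset (Finset.subset_univ _), Finset.card_univ, hcard,
    Finset.card_image_of_injOn, Finset.card_range, Nat.add_sub_cancel_left]
  intro i hi j hj h
  simp only [Finset.coe_range, Set.mem_Iio] at hi hj
  exact hinj i (by omega) j (by omega) h

variable [Fintype V] [DecidableEq V]

/-- The clique has `m + 1` vertices and a pendant edge at `P l`, whence the strict bound. The ratio
is at least `z (P l) / z (P 0)`, which is exactly the path growth. -/
theorem kiteAlong_spectral (hinj : ∀ i ≤ l, ∀ j ≤ l, P i = P j → i = j) {m : ℕ}
    (hcard : Fintype.card V = l + 1 + m) (hl : 1 ≤ l) :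
    ∃ (q : ℝ) (y : V → ℝ), (∀ v, 0 < y v) ∧ IsQEigen (kiteAlong P l) q y ∧ 2 * (m : ℝ) < q ∧
      pathGrowth q l ≤ principalRatio (kiteAlong P l) := by
  obtain ⟨z, a, b, hz, hz1, -, hmin, hE, hr⟩ :=
    exists_isQEigen_principalRatio (kiteAlong_connected hinj)
  refine ⟨_, z, hz, hE, ?_, ?_⟩
  · refine hE.clique_lt hz (S := Finset.univ \ (Finset.range l).image P) (b := P l)
      (c := P (l - 1)) (card_off_path hinj (by omega) (by omega)) ?_ ?_ ?_ ?_
    · intro u hu v hv huv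
      simp only [Finset.mem_sdiff, Finset.mem_univ, true_and, Finset.mem_image, Finset.mem_range,
        not_exists, not_and] at hu hv
      exact kiteAlong_adj_clique huv (fun i hi h => hu i hi h.symm) fun i hi h => hv i hi h.symm
    · simp only [Finset.mem_sdiff, Finset.mem_univ, true_and, Finset.mem_image, Finset.mem_range,
        not_exists, not_and]
      intro i hi h
      have := hinj _ (by omega) _ le_rfl h; omega
    · simp only [Finset.mem_sdiff, Finset.mem_univ, true_and, Finset.mem_image, Finset.mem_range,
        not_not]
      exact ⟨l - 1, by omega, rfl⟩
    · have := kiteAlong_adj_path hinj (i := l - 1) (by omega)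
      rw [show l - 1 + 1 = l by omega] at this
      exact this.symm
  · have h := hE.eq_pathGrowth hinj (fun hl u => kiteAlong_adj_start hinj hl u)
      (fun i hi u => kiteAlong_adj_mid hinj i hi u) l le_rfl
    rw [hr, le_div_iff₀ (hz a)]
    have h0 : 0 < pathGrowth (qSpectralRadius (kiteAlong P l)) l :=
      pos_of_mul_pos_left (h ▸ hz _) (hz _).le
    calc _ ≤ pathGrowth (qSpectralRadius (kiteAlong P l)) l * z (P 0) :=
          mul_le_mul_of_nonneg_left (hmin _) h0.le
      _ ≤ 1 := by rw [← h]; exact hz1 _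

theorem kiteAlong_iso {k : ℕ} (hinj : ∀ i ≤ l, ∀ j ≤ l, P i = P j → i = j)
    (hk : l + 1 + k - 1 = Fintype.card V) : Nonempty (kiteAlong P l ≃g kiteGraph (l + 1) k) := by
  classical
  have hl : l + 1 ≤ Fintype.card V := by
    have := Finset.card_le_univ ((Finset.range (l + 1)).image P)
    rwa [Finset.card_image_of_injOn, Finset.card_range] at this
    intro i hi j hj h
    simp only [Finset.coe_range, Set.mem_Iio] at hi hj
    exact hinj i (by omega) j (by omega) h
  obtain ⟨g, hg⟩ := Finset.exists_equiv_extend_of_card_eq (α := Fin (l + 1 + k - 1))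
    (t := (Finset.univ : Finset V)) (by rw [Fintype.card_fin, hk, Finset.card_univ])
    (s := Finset.univ.filter fun i : Fin (l + 1 + k - 1) => (i : ℕ) ≤ l)
    (f := fun i => P i) (Finset.subset_univ _) (by
      intro i hi j hj h
      simp only [Finset.coe_filter, Finset.mem_univ, true_and, Set.mem_ofPred_eq] at hi hj
      exact Fin.ext (hinj _ hi _ hj h))
  let e : Fin (l + 1 + k - 1) ≃ V := g.trans (Equiv.subtypeUnivEquiv Finset.mem_univ)
  have he : ∀ i : Fin (l + 1 + k - 1), (i : ℕ) ≤ l → e i = P i := fun i hi =>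
    hg i (by simpa using hi)
  have heq : ∀ (i : Fin (l + 1 + k - 1)) (j : ℕ), j ≤ l → (e i = P j ↔ (i : ℕ) = j) := by
    intro i j hj
    have hjc : j < l + 1 + k - 1 := by omega
    have h1 : P j = e ⟨j, hjc⟩ := (he ⟨j, hjc⟩ hj).symm
    rw [h1, e.apply_eq_iff_eq, Fin.ext_iff]
  refine ⟨RelIso.symm ⟨e, ?_⟩⟩
  intro i j
  change (e i ≠ e j ∧ ((∃ a < l, (e i = P a ∧ e j = P (a + 1)) ∨ (e j = P a ∧ e i = P (a + 1))) ∨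
    ((∀ a < l, e i ≠ P a) ∧ ∀ a < l, e j ≠ P a))) ↔ (((i : ℕ) < l + 1 ∧ (j : ℕ) < l + 1 ∧
      ((i : ℕ) + 1 = j ∨ (j : ℕ) + 1 = i)) ∨ (i ≠ j ∧ l + 1 ≤ (i : ℕ) + 1 ∧ l + 1 ≤ (j : ℕ) + 1))
  have hclq : ∀ x : Fin (l + 1 + k - 1), (∀ a < l, e x ≠ P a) ↔ l + 1 ≤ (x : ℕ) + 1 := by
    intro x
    constructor
    · intro h
      by_contra! hc
      exact h x (by omega) ((heq x x (by omega)).2 rfl)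
    · intro h a ha h'
      have := (heq x a ha.le).1 h'
      omega
  rw [hclq, hclq, e.injective.ne_iff]
  constructor
  · rintro ⟨hne, ⟨a, ha, ⟨h1, h2⟩ | ⟨h1, h2⟩⟩ | h⟩
    · rw [heq _ _ (by omega)] at h1 h2; omega
    · rw [heq _ _ (by omega)] at h1 h2; omega
    · exact Or.inr ⟨hne, h⟩
  · rintro (⟨h1, h2, h | h⟩ | ⟨hne, h⟩)
    · refine ⟨fun h' => by rw [h'] at h; omega, Or.inl ⟨i, by omega, Or.inl ⟨?_, ?_⟩⟩⟩
      · rw [heq _ _ (by omega)]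
      · rw [heq _ _ (by omega)]; omega
    · refine ⟨fun h' => by rw [h'] at h; omega, Or.inl ⟨j, by omega, Or.inr ⟨?_, ?_⟩⟩⟩
      · rw [heq _ _ (by omega)]
      · rw [heq _ _ (by omega)]; omega
    · exact ⟨hne, Or.inr h⟩

end Kite

/-! ### Structure near a geodesic from a smallest to a largest entry. -/

/-- A `Q`-eigenvector `z` with largest entry `1` at the end `P l` of the shortest path
`P 0, …, P l`, outside of which there are `m` vertices; `lev` is the distance from `P 0`. -/
structure GeodesicEigen {V : Type*} [Fintype V] (G : SimpleGraph V) (q : ℝ) (z : V → ℝ)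
    (P : ℕ → V) (lev : V → ℕ) (l m : ℕ) : Prop where
  card : Fintype.card V = l + 1 + m
  pos : ∀ v, 0 < z v
  le_one : ∀ v, z v ≤ 1
  top : z (P l) = 1
  eigen : IsQEigen G q z
  adj : ∀ i < l, G.Adj (P i) (P (i + 1))
  lev_path : ∀ i ≤ l, lev (P i) = i
  lev_adj : ∀ u v, G.Adj u v → lev v ≤ lev u + 1

namespace GeodesicEigen

variable {V : Type*} [Fintype V] {G : SimpleGraph V} {q : ℝ} {z : V → ℝ}
  {P : ℕ → V} {lev : V → ℕ} {l m : ℕ}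

theorem inj (h : GeodesicEigen G q z P lev l m) : ∀ i ≤ l, ∀ j ≤ l, P i = P j → i = j := by
  intro i hi j hj hij
  rw [← h.lev_path i hi, ← h.lev_path j hj, hij]

open Classical in
theorem le_two_mul_card (h : GeodesicEigen G q z P lev l m) :
    q ≤ 2 * ((Finset.univ.filter (G.Adj (P l))).card : ℝ) := by
  have h1 := h.eigen (P l)
  rw [h.top, mul_one] at h1
  rw [← h1, mul_comm, ← nsmul_eq_mul, ← Finset.sum_const]
  refine Finset.sum_le_sum fun u _ => ?_
  have := h.le_one u
  linarith

open Classical in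
theorem succ_le_card (h : GeodesicEigen G q z P lev l m) (hq : 2 * (m : ℝ) < q) :
    m + 1 ≤ (Finset.univ.filter (G.Adj (P l))).card := by
  have h1 := h.le_two_mul_card
  have : (m : ℝ) < ((Finset.univ.filter (G.Adj (P l))).card : ℝ) := by linarith
  exact_mod_cast this

variable [DecidableEq V]

/-- The possible neighbours of the end `P l` of a shortest path. -/
def core (P : ℕ → V) (l : ℕ) : Finset V :=
  Finset.univ \ insert (P l) ((Finset.range (l - 1)).image P)

theorem mem_core {v : V} : v ∈ core P l ↔ v ≠ P l ∧ ∀ i, i + 1 < l → v ≠ P i := by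
  simp only [core, Finset.mem_sdiff, Finset.mem_univ, true_and, Finset.mem_insert,
    Finset.mem_image, Finset.mem_range, not_or, not_exists, not_and]
  refine and_congr_right fun _ => ⟨fun h i hi h' => h i (by omega) h'.symm,
    fun h i hi h' => h i (by omega) h'.symm⟩

theorem card_insert_path (h : GeodesicEigen G q z P lev l m) :
    (insert (P l) ((Finset.range (l - 1)).image P)).card = l - 1 + 1 := by
  rw [Finset.card_insert_of_notMem, Finset.card_image_of_injOn, Finset.card_range]
  · intro i hi j hj hij
    simp only [Finset.coe_range, Set.mem_Iio] at hi hj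
    exact h.inj i (by omega) j (by omega) hij
  · simp only [Finset.mem_image, Finset.mem_range, not_exists, not_and]
    intro i hi hil
    have := h.inj i (by omega) l le_rfl hil
    omega

theorem card_core_le (h : GeodesicEigen G q z P lev l m) : (core P l).card ≤ m + 1 := by
  rw [core, Finset.card_sdiff_of_subset (Finset.subset_univ _), Finset.card_univ, h.card,
    h.card_insert_path]
  omega

theorem card_core (h : GeodesicEigen G q z P lev l m) (hl : 1 ≤ l) :
    (core P l).card = m + 1 := by
  rw [core, Finset.card_sdiff_of_subset (Finset.subset_univ _), Finset.card_univ, h.card,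
    h.card_insert_path]
  omega

theorem mem_core_of_adj (h : GeodesicEigen G q z P lev l m) {v : V} (hv : G.Adj (P l) v) :
    v ∈ core P l := by
  rw [mem_core]
  refine ⟨hv.ne', fun i hi hvi => ?_⟩
  have h1 := h.lev_adj _ _ hv.symm
  rw [hvi, h.lev_path i (by omega), h.lev_path l le_rfl] at h1
  omega

theorem le_two_mul (h : GeodesicEigen G q z P lev l m) : q ≤ 2 * ((m : ℝ) + 1) := by
  classical
  refine h.le_two_mul_card.trans ?_
  have : (Finset.univ.filter (G.Adj (P l))).card ≤ m + 1 :=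
    (Finset.card_le_card fun u hu => h.mem_core_of_adj (by simpa using hu)).trans h.card_core_le
  have : ((Finset.univ.filter (G.Adj (P l))).card : ℝ) ≤ (m : ℝ) + 1 := by exact_mod_cast this
  linarith

/-- `q > 2m` forces more than `m` neighbours of `P l`, all inside a set of at most `m + 1` vertices.
-/
theorem adj_iff (h : GeodesicEigen G q z P lev l m) (hq : 2 * (m : ℝ) < q) (v : V) :
    G.Adj (P l) v ↔ v ∈ core P l := by
  classical
  refine ⟨h.mem_core_of_adj, fun hv => ?_⟩
  have : Finset.univ.filter (G.Adj (P l)) = core P l :=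
    Finset.eq_of_subset_of_card_le (fun u hu => h.mem_core_of_adj (by simpa using hu))
      (h.card_core_le.trans (h.succ_le_card hq))
  rw [← this] at hv
  simpa using hv

theorem sum_core (h : GeodesicEigen G q z P lev l m) (hq : 2 * (m : ℝ) < q) :
    ∑ u ∈ core P l, (1 + z u) = q := by
  have := h.eigen.sum_eq (h.adj_iff hq)
  rwa [h.top, mul_one] at this

/-- The eigenvalue equation at `P l`, rewritten as a budget: it limits how many core entries can be
far from 1. -/
theorem sum_deficiency (h : GeodesicEigen G q z P lev l m) (hq : 2 * (m : ℝ) < q) (hl : 1 ≤ l) :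
    ∑ u ∈ core P l, (1 - z u) = 2 * ((m : ℝ) + 1) - q := by
  have h1 := h.sum_core hq
  rw [Finset.sum_add_distrib, Finset.sum_const, h.card_core hl, nsmul_eq_mul] at h1
  rw [Finset.sum_sub_distrib, Finset.sum_const, h.card_core hl, nsmul_eq_mul]
  push_cast at h1 ⊢
  linarith

theorem le_lev_of_mem_core (h : GeodesicEigen G q z P lev l m) (hq : 2 * (m : ℝ) < q) {v : V}
    (hv : v ∈ core P l) : l ≤ lev v + 1 := by
  have := h.lev_adj _ _ ((h.adj_iff hq v).2 hv).symm
  rwa [h.lev_path l le_rfl] at this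

variable {r : ℕ}

/-- Core vertices are adjacent to `P (r + 3)`, so their level is at least `r + 2`; everything lower
is on the path. -/
theorem exists_path_of_lev (h : GeodesicEigen G q z P lev (r + 3) m) (hq : 2 * (m : ℝ) < q)
    {v : V} (hv : lev v ≤ r + 1) : ∃ j ≤ r + 1, v = P j ∧ lev v = j := by
  by_contra! hcon
  have : v ∈ core P (r + 3) := by
    rw [mem_core]
    refine ⟨?_, fun i hi hvi => ?_⟩
    · rintro rfl
      rw [h.lev_path _ le_rfl] at hv; omega
    · refine hcon i (by omega) hvi ?_
      rw [hvi, h.lev_path i (by omega)]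
  have := h.le_lev_of_mem_core hq this
  omega

theorem adj_path (h : GeodesicEigen G q z P lev (r + 3) m) (hq : 2 * (m : ℝ) < q) {i : ℕ}
    (hi : i ≤ r) {u : V} (hu : G.Adj (P i) u) : u = P (i + 1) ∨ (1 ≤ i ∧ u = P (i - 1)) := by
  have h1 := h.lev_adj _ _ hu
  have h2 := h.lev_adj _ _ hu.symm
  rw [h.lev_path i (by omega)] at h1 h2
  obtain ⟨j, hj, rfl, h3⟩ := h.exists_path_of_lev hq (v := u) (by omega)
  have hne : j ≠ i := by rintro rfl; exact hu.ne rfl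
  obtain rfl | ⟨hi, rfl⟩ : j = i + 1 ∨ (1 ≤ i ∧ j = i - 1) := by omega
  · exact Or.inl rfl
  · exact Or.inr ⟨hi, rfl⟩

theorem eq_pathGrowth (h : GeodesicEigen G q z P lev (r + 3) m) (hq : 2 * (m : ℝ) < q) :
    ∀ j ≤ r + 1, z (P j) = pathGrowth q j * z (P 0) := by
  refine h.eigen.eq_pathGrowth (fun i hi j hj => h.inj i (by omega) j (by omega)) ?_ ?_
  · intro _ u
    refine ⟨fun hu => ?_, ?_⟩
    · rcases h.adj_path hq (by omega) hu with h1 | ⟨h1, -⟩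
      · exact h1
      · omega
    · rintro rfl; exact h.adj 0 (by omega)
  · intro i hi u
    refine ⟨fun hu => ?_, ?_⟩
    · rcases h.adj_path hq (by omega) hu with h1 | ⟨-, h1⟩
      · exact Or.inr h1
      · exact Or.inl h1
    · rintro (rfl | rfl)
      · exact (h.adj i (by omega)).symm
      · exact h.adj (i + 1) (by omega)

open Classical in
/-- The neighbours of the third-to-last path vertex among the neighbours of the last one. -/
noncomputable def gate (G : SimpleGraph V) (P : ℕ → V) (r : ℕ) : Finset V :=
  (core P (r + 3)).filter (G.Adj (P (r + 1)))

theorem mem_gate {v : V} : v ∈ gate G P r ↔ v ∈ core P (r + 3) ∧ G.Adj (P (r + 1)) v := by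
  simp [gate]

theorem path_mem_gate (h : GeodesicEigen G q z P lev (r + 3) m) (hq : 2 * (m : ℝ) < q) :
    P (r + 2) ∈ gate G P r :=
  mem_gate.2 ⟨(h.adj_iff hq _).1 (h.adj (r + 2) (by omega)).symm, h.adj (r + 1) (by omega)⟩

theorem path_notMem_core (i : ℕ) (hi : i ≤ r + 1) : P i ∉ core P (r + 3) := by
  rw [mem_core]
  exact fun h => h.2 i (by omega) rfl

theorem adj_gate_iff (h : GeodesicEigen G q z P lev (r + 3) m) (u : V) :
    G.Adj (P (r + 1)) u ↔ u ∈ insert (P r) (gate G P r) := by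
  rw [Finset.mem_insert, mem_gate]
  constructor
  · intro hu
    by_cases hc : u ∈ core P (r + 3)
    · exact Or.inr ⟨hc, hu⟩
    · left
      rw [mem_core] at hc
      have h2 := h.lev_adj _ _ hu.symm
      have h3 := h.lev_adj _ _ hu
      rw [h.lev_path (r + 1) (by omega)] at h2 h3
      have hl : u ≠ P (r + 3) := by
        rintro rfl
        rw [h.lev_path _ le_rfl] at h3; omega
      push Not at hc
      obtain ⟨i, hi, rfl⟩ := hc hl
      rw [h.lev_path i (by omega)] at h2
      have hne : i ≠ r + 1 := by rintro rfl; exact hu.ne rfl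
      obtain rfl : i = r := by omega
      rfl
  · rintro (rfl | ⟨-, hu⟩)
    · exact (h.adj r (by omega)).symm
    · exact hu

/-- The equation at `P (r + 1)` is one more step of the pendant recursion, with the whole gate in
place of the next vertex. -/
theorem sum_gate_le (h : GeodesicEigen G q z P lev (r + 3) m) (hq : 2 * (m : ℝ) < q) :
    ∑ u ∈ gate G P r, z u ≤ pathGrowth q (r + 2) * z (P 0) := by
  have h1 := h.eigen.sum_eq (h.adj_gate_iff)
  rw [Finset.sum_insert (fun hc => path_notMem_core r (by omega) (mem_gate.1 hc).1),
    Finset.sum_add_distrib, Finset.sum_const, nsmul_eq_mul] at h1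
  have h2 := h.eq_pathGrowth hq r (by omega)
  have h3 := h.eq_pathGrowth hq (r + 1) le_rfl
  have h4 : (1 : ℝ) ≤ (gate G P r).card := by
    exact_mod_cast Finset.card_pos.2 ⟨_, h.path_mem_gate hq⟩
  have h5 := h.pos (P (r + 1))
  rw [pathGrowth]
  nlinarith

theorem adj_off_gate (h : GeodesicEigen G q z P lev (r + 3) m) (hq : 2 * (m : ℝ) < q) {o u : V}
    (ho : o ∈ core P (r + 3)) (hog : o ∉ gate G P r) (hu : G.Adj o u) :
    u = P (r + 3) ∨ u ∈ core P (r + 3) := by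
  by_contra! hcon
  obtain ⟨h1, h2⟩ := hcon
  rw [mem_core] at h2
  push Not at h2
  obtain ⟨i, hi, rfl⟩ := h2 h1
  have h3 := h.le_lev_of_mem_core hq ho
  have h4 := h.lev_adj _ _ hu.symm
  rw [h.lev_path i (by omega)] at h4
  obtain rfl : i = r + 1 := by omega
  exact hog (mem_gate.2 ⟨ho, hu.symm⟩)

/-- A missing edge in the core forces a small entry of the eigenvector. -/
theorem deficiency_of_not_adj (h : GeodesicEigen G q z P lev (r + 3) m) (hq : 2 * (m : ℝ) < q)
    {o u : V} (ho : o ∈ core P (r + 3)) (hog : o ∉ gate G P r) (hu : u ∈ core P (r + 3))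
    (hou : o ≠ u) (hna : ¬ G.Adj u o) : 1 + z u ≤ ((m : ℝ) + 3) * (1 - z o) := by
  classical
  have hb : P (r + 3) ∉ ((core P (r + 3)).erase o).erase u := fun hc =>
    (mem_core.1 (Finset.mem_of_mem_erase (Finset.mem_of_mem_erase hc))).1 rfl
  -- The equation at `o` is to be subtracted from the one at `P (r + 3)`, whose entry is 1: the
  -- neighbours of `o` lie in the same core, with `o` and `u` removed and `P (r + 3)` added.
  have h1 : q * z o ≤ ∑ x ∈ insert (P (r + 3)) (((core P (r + 3)).erase o).erase u),
      (z o + z x) := by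
    rw [← h.eigen o]
    refine Finset.sum_le_sum_of_subset_of_nonneg ?_ fun x _ _ =>
      (add_pos (h.pos o) (h.pos x)).le
    intro x hx
    have hx : G.Adj o x := by simpa using hx
    rw [Finset.mem_insert, Finset.mem_erase, Finset.mem_erase]
    rcases h.adj_off_gate hq ho hog hx with h2 | h2
    · exact Or.inl h2
    · refine Or.inr ⟨?_, hx.ne', h2⟩
      rintro rfl
      exact hna hx.symm
  rw [Finset.sum_insert hb, h.top] at h1
  have hu' : u ∈ (core P (r + 3)).erase o := Finset.mem_erase.2 ⟨hou.symm, hu⟩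
  have h2 := Finset.add_sum_erase _ (fun x => z o + z x) hu'
  have h3 := Finset.add_sum_erase _ (fun x => z o + z x) ho
  have h4 := h.sum_core hq
  rw [Finset.sum_add_distrib, Finset.sum_const, h.card_core (by omega), nsmul_eq_mul] at h4
  rw [Finset.sum_add_distrib (s := core P (r + 3)), Finset.sum_const, h.card_core (by omega),
    nsmul_eq_mul] at h3
  push_cast at h3 h4
  have h5 := h.le_two_mul
  have h6 := h.le_one o
  nlinarith

theorem sum_le_of_mem_gate (h : GeodesicEigen G q z P lev (r + 3) m) (hq : 2 * (m : ℝ) < q)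
    {u : V} (hu : u ∈ gate G P r) {A : Finset V} (hA : ∀ o ∈ A, o ∈ core P (r + 3) ∧ G.Adj u o) :
    1 + ∑ o ∈ A, z o ≤ q * z u := by
  have hb : P (r + 3) ∉ A := fun hc => (mem_core.1 (hA _ hc).1).1 rfl
  have h1 := h.eigen.sum_le h.pos (v := u) (S := insert (P (r + 3)) A) (by
    intro x hx
    rcases Finset.mem_insert.1 hx with rfl | hx
    · exact ((h.adj_iff hq u).2 (mem_gate.1 hu).1).symm
    · exact (hA x hx).2)
  rw [Finset.sum_insert hb, h.top, Finset.sum_add_distrib, Finset.sum_const, nsmul_eq_mul] at h1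
  have h2 := h.pos u
  have : 0 ≤ (A.card : ℝ) * z u := by positivity
  linarith

theorem le_kiteAlong (h : GeodesicEigen G q z P lev (r + 3) m) (hq : 2 * (m : ℝ) < q)
    (hgate : gate G P r = {P (r + 2)})
    (hA : ∀ o ∈ core P (r + 3), ¬ G.Adj (P (r + 2)) o) : G ≤ kiteAlong P (r + 3) := by
  have key : ∀ i < r + 3, ∀ y, G.Adj (P i) y → (kiteAlong P (r + 3)).Adj (P i) y := by
    intro i hi y hy
    have hcase : (i + 1 ≤ r + 3 ∧ y = P (i + 1)) ∨ (1 ≤ i ∧ y = P (i - 1)) := by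
      by_cases hir : i ≤ r
      · rcases h.adj_path hq hir hy with h1 | h1
        · exact Or.inl ⟨by omega, h1⟩
        · exact Or.inr h1
      · obtain rfl | rfl : i = r + 1 ∨ i = r + 2 := by omega
        · rw [h.adj_gate_iff, hgate, Finset.mem_insert, Finset.mem_singleton] at hy
          rcases hy with rfl | rfl
          · exact Or.inr ⟨by omega, rfl⟩
          · exact Or.inl ⟨by omega, rfl⟩
        · have h1 : y ∉ core P (r + 3) := fun hc => hA y hc hy
          rw [mem_core] at h1
          push Not at h1
          by_cases hyl : y = P (r + 3)
          · exact Or.inl ⟨le_rfl, hyl⟩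
          · obtain ⟨j, hj, rfl⟩ := h1 hyl
            have h2 := h.lev_adj _ _ hy.symm
            rw [h.lev_path _ (by omega), h.lev_path _ (by omega)] at h2
            obtain rfl : j = r + 1 := by omega
            exact Or.inr ⟨by omega, rfl⟩
    rcases hcase with ⟨h1, rfl⟩ | ⟨h1, rfl⟩
    · exact kiteAlong_adj_path h.inj hi
    · have := kiteAlong_adj_path h.inj (i := i - 1) (by omega)
      rw [show i - 1 + 1 = i by omega] at this
      exact this.symm
  intro x y hxy
  by_cases hx : ∃ i < r + 3, x = P i
  · obtain ⟨i, hi, rfl⟩ := hx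
    exact key i hi y hxy
  by_cases hy : ∃ i < r + 3, y = P i
  · obtain ⟨i, hi, rfl⟩ := hy
    exact (key i hi x hxy.symm).symm
  push Not at hx hy
  exact kiteAlong_adj_clique hxy.ne hx hy

end GeodesicEigen

/-! ### Using the competitors: the maximizer is a kite. -/

namespace GeodesicEigen

variable {V : Type*} [Fintype V] {G : SimpleGraph V} {q q' : ℝ} {z y : V → ℝ}
  {P : ℕ → V} {lev : V → ℕ} {r m : ℕ} {L : ℝ}

/-- A smaller `q` could not lift `z (P 0)` to the value 1 at `P (r + 3)`, since even growth at rate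
`q'` reaches at most 1. -/
theorem le_value (h : GeodesicEigen G q z P lev (r + 3) m) (hm : 100 ≤ m)
    (hq' : 2 * (m : ℝ) < q') (hB : pathGrowth q' (r + 3) * z (P 0) ≤ 1) : q' ≤ q := by
  have hm' : (100 : ℝ) ≤ m := by exact_mod_cast hm
  by_contra! hlt
  have hz0 := h.pos (P 0)
  by_cases hq4 : 4 ≤ q
  · have h1 := h.eigen.le_pathGrowth h.pos hq4 h.adj h.inj (r + 3) le_rfl
    rw [h.top] at h1
    have h2 := pathGrowth_strictMono hq4 hlt (j := r + 3) (by omega)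
    have := mul_lt_mul_of_pos_right h2 hz0
    linarith
  -- The growth estimates need `q ≥ 4`; below 4 the bound `q ^ j` is enough, because `q' - 3`
  -- exceeds 4.
  · push Not at hq4
    have hq0 : 0 ≤ q := by
      have h1 := h.eigen.add_le h.pos (h.adj (r + 2) (by omega)).symm
      rw [h.top] at h1
      have := h.pos (P (r + 2))
      linarith
    have h1 := h.eigen.le_pow h.pos hq0 h.adj (r + 3) le_rfl
    rw [h.top] at h1
    have h2 : q ^ (r + 3) < (q' - 3) ^ (r + 3) := pow_lt_pow_left₀ (by linarith) hq0 (by omega)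
    have h3 := pow_le_pathGrowth (by linarith : 4 ≤ q') (r + 3)
    have := mul_lt_mul_of_pos_right (h2.trans_le h3) hz0
    linarith

variable [DecidableEq V]

/-- Lowering the value from `2(m + 1)` to `q` costs a factor `(q / (2(m + 1))) ^ (r + 2)` in growth,
at most `exp (-D L)`; the exponential is truncated at second order. -/
theorem sum_gate_decay (h : GeodesicEigen G q z P lev (r + 3) m) (hq : 2 * (m : ℝ) < q)
    (hm : 2 ≤ m) (hA : pathGrowth (2 * ((m : ℝ) + 1)) (r + 2) * z (P 0) ≤ 1)
    (hL : L * (2 * ((m : ℝ) + 1)) = r + 2) :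
    (∑ u ∈ gate G P r, z u) * (1 + (2 * ((m : ℝ) + 1) - q) * L
      + ((2 * ((m : ℝ) + 1) - q) * L) ^ 2 / 2) ≤ 1 := by
  have hm' : (2 : ℝ) ≤ m := by exact_mod_cast hm
  set s := ∑ u ∈ gate G P r, z u with hs
  set Q := 2 * ((m : ℝ) + 1) with hQ
  have hs0 : 0 ≤ s := Finset.sum_nonneg fun u _ => (h.pos u).le
  have hqQ : q ≤ Q := h.le_two_mul
  have hQ0 : 0 < Q := by linarith
  have hq0 : 0 < q := by linarith
  have h1 : (Q / q) ^ (r + 2) * s ≤ 1 := by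
    have h2 := pow_mul_pathGrowth_le (by linarith : 4 ≤ q) hqQ (r + 2)
    have h3 : 0 < (Q / q) ^ (r + 2) := by positivity
    calc (Q / q) ^ (r + 2) * s ≤ (Q / q) ^ (r + 2) * (pathGrowth q (r + 2) * z (P 0)) :=
          mul_le_mul_of_nonneg_left (h.sum_gate_le hq) h3.le
      _ = ((Q / q) ^ (r + 2) * pathGrowth q (r + 2)) * z (P 0) := by ring
      _ ≤ pathGrowth Q (r + 2) * z (P 0) := mul_le_mul_of_nonneg_right h2 (h.pos _).le
      _ ≤ 1 := hA
  have h4 : Real.exp ((Q - q) * L) ≤ (Q / q) ^ (r + 2) := by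
    have h5 : Real.exp ((Q - q) / Q) ≤ Q / q := by
      have h6 := Real.add_one_le_exp (-((Q - q) / Q))
      have h7 : -((Q - q) / Q) + 1 = q / Q := by field_simp; ring
      rw [h7, Real.exp_neg] at h6
      have h8 := (le_inv_comm₀ (by positivity) (Real.exp_pos _)).1 h6
      rwa [inv_div] at h8
    have h9 : (Q - q) * L = ((r + 2 : ℕ) : ℝ) * ((Q - q) / Q) := by
      push_cast
      rw [← hL]; field_simp
    rw [h9, Real.exp_nat_mul]
    exact pow_le_pow_left₀ (Real.exp_pos _).le h5 _
  have hL0 : 0 ≤ L := by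
    by_contra! hneg
    have : L * Q < 0 := mul_neg_of_neg_of_pos hneg hQ0
    rw [hL] at this
    have : (0 : ℝ) ≤ r + 2 := by positivity
    linarith
  have hX : 0 ≤ (Q - q) * L := mul_nonneg (by linarith) hL0
  have h10 := Real.quadratic_le_exp_of_nonneg hX
  calc s * (1 + (Q - q) * L + ((Q - q) * L) ^ 2 / 2) ≤ s * (Q / q) ^ (r + 2) :=
        mul_le_mul_of_nonneg_left (h10.trans h4) hs0
    _ ≤ 1 := by rw [mul_comm]; exact h1

theorem sum_gate_le_one (h : GeodesicEigen G q z P lev (r + 3) m) (hq : 2 * (m : ℝ) < q)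
    (hm : 2 ≤ m) (hA : pathGrowth (2 * ((m : ℝ) + 1)) (r + 2) * z (P 0) ≤ 1)
    (hL : L * (2 * ((m : ℝ) + 1)) = r + 2) :
    (∑ u ∈ gate G P r, z u) * (1 + (2 * ((m : ℝ) + 1) - q) * L) ≤ 1 := by
  have h1 := h.sum_gate_decay hq hm hA hL
  have hs0 : 0 ≤ ∑ u ∈ gate G P r, z u := Finset.sum_nonneg fun u _ => (h.pos u).le
  nlinarith [mul_nonneg hs0 (sq_nonneg ((2 * ((m : ℝ) + 1) - q) * L))]

theorem gate_subset : gate G P r ⊆ core P (r + 3) := fun _ hu => (mem_gate.1 hu).1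

theorem sum_off_gate (h : GeodesicEigen G q z P lev (r + 3) m) (hq : 2 * (m : ℝ) < q) :
    ∑ o ∈ core P (r + 3) \ gate G P r, (1 - z o)
      = 2 * ((m : ℝ) + 1) - q - ((gate G P r).card - ∑ u ∈ gate G P r, z u) := by
  have h1 := Finset.sum_sdiff (f := fun o => 1 - z o) (gate_subset (G := G) (P := P) (r := r))
  rw [h.sum_deficiency hq (by omega), Finset.sum_sub_distrib (s := gate G P r), Finset.sum_const,
    nsmul_eq_mul, mul_one] at h1
  linarith

/-- With two gate vertices `D ≥ 1`, so both entries are tiny. A tiny entry at `u` allows few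
neighbours, and each missing edge to the core costs about `1/m` of deficiency, about 1 in all.
Nothing like that is left in the budget. -/
theorem card_gate (h : GeodesicEigen G q z P lev (r + 3) m) (hq : 2 * (m : ℝ) < q)
    (hm : 100 ≤ m) (hA : pathGrowth (2 * ((m : ℝ) + 1)) (r + 2) * z (P 0) ≤ 1)
    (hL : L * (2 * ((m : ℝ) + 1)) = r + 2) (hL0 : 100 ≤ L) : (gate G P r).card = 1 := by
  classical
  have hm' : (100 : ℝ) ≤ m := by exact_mod_cast hm
  have hD0 := h.le_two_mul
  have hdecay := h.sum_gate_le_one hq (by omega) hA hL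
  have hoff := h.sum_off_gate hq
  have hoff0 : 0 ≤ ∑ o ∈ core P (r + 3) \ gate G P r, (1 - z o) :=
    Finset.sum_nonneg fun o _ => by linarith [h.le_one o]
  have hs0 : 0 ≤ ∑ u ∈ gate G P r, z u := Finset.sum_nonneg fun u _ => (h.pos u).le
  set s := ∑ u ∈ gate G P r, z u with hs
  set D := 2 * ((m : ℝ) + 1) - q with hD
  have hDL : 0 ≤ D * L := mul_nonneg (by linarith) (by linarith)
  have hs1 : s ≤ 1 := by nlinarith
  have hpos : 0 < (gate G P r).card := Finset.card_pos.2 ⟨_, h.path_mem_gate hq⟩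
  by_contra hne
  -- The budget gives at most `D + s` gate vertices, where `D < 2` and `s ≤ 1`.
  have hlt3 : (gate G P r).card < 3 := by
    by_contra! h3
    have : (3 : ℝ) ≤ (gate G P r).card := by exact_mod_cast h3
    linarith
  have h2 : (gate G P r).card = 2 := by omega
  have hu := h.path_mem_gate hq
  set u := P (r + 2) with hudef
  rw [h2] at hoff
  push_cast at hoff
  have hus : z u ≤ s := Finset.single_le_sum (f := z) (fun v _ => (h.pos v).le) hu
  have hs100 : s ≤ 1 / 100 := by
    have : L ≤ D * L := le_mul_of_one_le_left (by linarith) (by linarith)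
    nlinarith
  have hcard : ((core P (r + 3) \ gate G P r).card : ℝ) = m - 1 := by
    rw [Finset.card_sdiff_of_subset gate_subset, h.card_core (by omega), h2,
      Nat.cast_sub (by omega)]
    push_cast; ring
  have hterm : ∀ o ∈ core P (r + 3) \ gate G P r,
      1 ≤ (if G.Adj u o then z o else 0) + ((m : ℝ) + 3) * (1 - z o) := by
    intro o ho
    rw [Finset.mem_sdiff] at ho
    split_ifs with hadj
    · have := h.le_one o
      nlinarith
    · have hou : o ≠ u := by rintro rfl; exact ho.2 hu
      have := h.deficiency_of_not_adj hq ho.1 ho.2 (mem_gate.1 hu).1 hou hadj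
      have := h.pos u
      linarith
  have hsum := Finset.sum_le_sum hterm
  rw [Finset.sum_const, nsmul_eq_mul, hcard, mul_one, Finset.sum_add_distrib, ← Finset.mul_sum,
    ← Finset.sum_filter, hoff] at hsum
  have hadj := h.sum_le_of_mem_gate hq hu
    (A := (core P (r + 3) \ gate G P r).filter (G.Adj u)) (fun o ho => by
      rw [Finset.mem_filter, Finset.mem_sdiff] at ho
      exact ⟨ho.1.1, ho.2⟩)
  have hz0 := h.pos u
  nlinarith

theorem gate_entry_small (h : GeodesicEigen G q z P lev (r + 3) m) (hq : 2 * (m : ℝ) < q)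
    (hm : 100 ≤ m) (hA : pathGrowth (2 * ((m : ℝ) + 1)) (r + 2) * z (P 0) ≤ 1)
    (hL : L * (2 * ((m : ℝ) + 1)) = r + 2) (hL0 : 2000 ≤ L)
    (hgate : gate G P r = {P (r + 2)}) : z (P (r + 2)) * L ≤ 1 / 250 := by
  classical
  have hm' : (100 : ℝ) ≤ m := by exact_mod_cast hm
  have hD0 := h.le_two_mul
  have hdecay1 := h.sum_gate_le_one hq (by omega) hA hL
  have hdecay2 := h.sum_gate_decay hq (by omega) hA hL
  have hoff := h.sum_off_gate hq
  have hu := h.path_mem_gate hq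
  have hoff0 : 0 ≤ ∑ o ∈ core P (r + 3) \ gate G P r, (1 - z o) :=
    Finset.sum_nonneg fun o _ => by linarith [h.le_one o]
  have hcard : ((core P (r + 3) \ gate G P r).card : ℝ) = m := by
    rw [Finset.card_sdiff_of_subset gate_subset, h.card_core (by omega), hgate,
      Finset.card_singleton, Nat.add_sub_cancel]
  have huc := (mem_gate.1 hu).1
  have hcu := (mem_gate.1 hu).2
  have hbu := (h.adj_iff hq _).2 huc
  have hdef : ∀ o ∈ core P (r + 3) \ gate G P r, ¬ G.Adj (P (r + 2)) o →
      1 + z (P (r + 2)) ≤ ((m : ℝ) + 3) * (1 - z o) := by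
    intro o ho hadj
    rw [Finset.mem_sdiff] at ho
    refine h.deficiency_of_not_adj hq ho.1 ho.2 huc ?_ hadj
    rintro rfl; exact ho.2 hu
  rw [hgate, Finset.sum_singleton] at hdecay1 hdecay2
  rw [hgate, Finset.sum_singleton, Finset.card_singleton, Nat.cast_one] at hoff
  rw [hgate] at hoff0 hcard hdef
  set u := P (r + 2) with hudef
  have hy0 := h.pos u
  have hy1 := h.le_one u
  set D := 2 * ((m : ℝ) + 1) - q with hD
  -- The decay inequality alone admits `z u = 1`, `D = 0`. Then all core entries are 1 and `u` is
  -- joined to the rest of the core, to `P (r + 3)` and to `P (r + 1)`, which exceeds `q = 2(m +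
  -- 1)`.
  have hne1 : z u ≠ 1 := by
    intro hone
    rw [hone] at hdecay1
    have hDz : D = 0 := by nlinarith
    rw [hDz, hone] at hoff
    have hall : ∀ o ∈ core P (r + 3) \ {u}, 1 - z o = 0 :=
      (Finset.sum_eq_zero_iff_of_nonneg fun o _ => by linarith [h.le_one o]).1
        (by rw [hoff]; ring)
    have hadj : ∀ o ∈ core P (r + 3) \ {u}, G.Adj u o := by
      intro o ho
      by_contra hna
      have := hdef o ho hna
      rw [hall o ho] at this
      linarith
    have hcR : P (r + 1) ∉ core P (r + 3) \ {u} := fun hc =>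
      path_notMem_core (r + 1) le_rfl (Finset.mem_sdiff.1 hc).1
    have hbR : P (r + 3) ∉ insert (P (r + 1)) (core P (r + 3) \ {u}) := by
      rw [Finset.mem_insert, Finset.mem_sdiff, mem_core]
      rintro (hc | hc)
      · have := h.inj _ le_rfl _ (by omega) hc; omega
      · exact hc.1.1 rfl
    have hsum := h.eigen.sum_le h.pos (v := u)
      (S := insert (P (r + 3)) (insert (P (r + 1)) (core P (r + 3) \ {u}))) (by
        intro x hx
        rw [Finset.mem_insert, Finset.mem_insert] at hx
        rcases hx with rfl | rfl | hx
        · exact hbu.symm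
        · exact hcu.symm
        · exact hadj x hx)
    have hR : ∑ o ∈ core P (r + 3) \ {u}, (z u + z o) = 2 * m := by
      rw [Finset.sum_congr rfl fun o ho => show z u + z o = 2 by linarith [hall o ho],
        Finset.sum_const, nsmul_eq_mul, hcard, mul_comm]
    rw [Finset.sum_insert hbR, Finset.sum_insert hcR, hR, h.top, hone] at hsum
    have := h.pos (P (r + 1))
    linarith
  have hylt : z u < 1 := lt_of_le_of_ne hy1 hne1
  have hDge : 1 - z u ≤ D := by linarith
  have hyL : z u * L ≤ 1 := by
    have h1 : (1 - z u) * L ≤ D * L := mul_le_mul_of_nonneg_right hDge (by linarith)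
    have h2 : z u * ((1 - z u) * L) ≤ z u * (D * L) := mul_le_mul_of_nonneg_left h1 hy0.le
    have h3 : (1 - z u) * (z u * L) ≤ (1 - z u) * 1 := by linarith
    exact le_of_mul_le_mul_left h3 (by linarith)
  have hysmall : z u ≤ 1 / 2000 := by nlinarith
  have hDL : L / 2 ≤ D * L := by nlinarith
  -- Now `D ≥ 1/2`, so the quadratic term gives `z u * L ^ 2 ≤ 8`; the bound `1/250` is `8/2000`.
  have h1 : (L / 2) ^ 2 ≤ (D * L) ^ 2 := pow_le_pow_left₀ (by linarith) hDL 2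
  have h2 : z u * ((L / 2) ^ 2 / 2) ≤ 1 := by
    have : 0 ≤ z u * (D * L) := mul_nonneg hy0.le (by linarith)
    nlinarith
  have h3 : (z u * L) * L ≤ 8 := by linarith
  have h4 : (z u * L) * 2000 ≤ (z u * L) * L :=
    mul_le_mul_of_nonneg_left hL0 (mul_nonneg hy0.le (by linarith))
  linarith

/-- An edge from `u = P (r + 2)` into the core would give `q * z u` close to 2 or more, since its
other end has entry near 1. But `q` is so close to `2m` that the kite on the same path bounds `2m *
z u` by little more than 1. -/
theorem not_adj_core (h : GeodesicEigen G q z P lev (r + 3) m) (hq : 2 * (m : ℝ) < q)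
    (hm : 100 ≤ m) (hA : pathGrowth (2 * ((m : ℝ) + 1)) (r + 2) * z (P 0) ≤ 1)
    (hB : pathGrowth (2 * (m : ℝ)) (r + 3) * z (P 0) ≤ 1)
    (hL : L * (2 * ((m : ℝ) + 1)) = r + 2) (hL0 : 2000 ≤ L) (hLm : 1000 * L ≤ m)
    (hgate : gate G P r = {P (r + 2)}) : ∀ o ∈ core P (r + 3), ¬ G.Adj (P (r + 2)) o := by
  classical
  have hm' : (100 : ℝ) ≤ m := by exact_mod_cast hm
  have hD0 := h.le_two_mul
  have hyL2 := h.gate_entry_small hq hm hA hL hL0 hgate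
  have hoff := h.sum_off_gate hq
  have hsle := h.sum_gate_le hq
  have hu := h.path_mem_gate hq
  have hcard : ((core P (r + 3) \ gate G P r).card : ℝ) = m := by
    rw [Finset.card_sdiff_of_subset gate_subset, h.card_core (by omega), hgate,
      Finset.card_singleton, Nat.add_sub_cancel]
  have huc := (mem_gate.1 hu).1
  have hdef : ∀ o ∈ core P (r + 3) \ gate G P r, ¬ G.Adj (P (r + 2)) o →
      1 + z (P (r + 2)) ≤ ((m : ℝ) + 3) * (1 - z o) := by
    intro o ho hadj
    rw [Finset.mem_sdiff] at ho
    refine h.deficiency_of_not_adj hq ho.1 ho.2 huc ?_ hadj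
    rintro rfl; exact ho.2 hu
  rw [hgate, Finset.sum_singleton] at hsle
  rw [hgate, Finset.sum_singleton, Finset.card_singleton, Nat.cast_one] at hoff
  rw [hgate] at hcard hdef
  intro o ho hadj
  set u := P (r + 2) with hudef
  have hy0 := h.pos u
  have hy1 := h.le_one u
  set D := 2 * ((m : ℝ) + 1) - q with hD
  set R := core P (r + 3) \ {u} with hRdef
  set A := R.filter (G.Adj u) with hAdef
  have hoA : o ∈ A := by
    rw [hAdef, Finset.mem_filter, hRdef, Finset.mem_sdiff, Finset.mem_singleton]
    exact ⟨⟨ho, hadj.ne'⟩, hadj⟩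
  have hA1 := h.sum_le_of_mem_gate hq hu (A := A) (fun o ho => by
    rw [hAdef, Finset.mem_filter, hRdef, Finset.mem_sdiff] at ho
    exact ⟨ho.1.1, ho.2⟩)
  have ha1 : (1 : ℝ) ≤ A.card := by exact_mod_cast Finset.card_pos.2 ⟨o, hoA⟩
  have hsplit := Finset.sum_filter_add_sum_filter_not R (G.Adj u) (fun o => 1 - z o)
  have hcsplit : (A.card : ℝ) + (R.filter fun o => ¬ G.Adj u o).card = m := by
    rw [← hcard]; exact_mod_cast Finset.card_filter_add_card_filter_not (s := R) (G.Adj u)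
  have hnon := Finset.sum_le_sum (s := R.filter fun o => ¬ G.Adj u o) fun o ho =>
    hdef o (Finset.mem_filter.1 ho).1 (Finset.mem_filter.1 ho).2
  rw [Finset.sum_const, nsmul_eq_mul, ← Finset.mul_sum] at hnon
  have hAz : ∑ o ∈ A, (1 - z o) = A.card - ∑ o ∈ A, z o := by
    rw [Finset.sum_sub_distrib, Finset.sum_const, nsmul_eq_mul, mul_one]
  have hA0 : 0 ≤ ∑ o ∈ A, (1 - z o) :=
    Finset.sum_nonneg fun o _ => by linarith [h.le_one o]
  have hN0 : 0 ≤ ∑ o ∈ R.filter (fun o => ¬ G.Adj u o), (1 - z o) :=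
    Finset.sum_nonneg fun o _ => by linarith [h.le_one o]
  rw [hoff] at hsplit
  set SA := ∑ o ∈ A, (1 - z o) with hSA
  set SN := ∑ o ∈ R.filter (fun o => ¬ G.Adj u o), (1 - z o) with hSN
  set a := (A.card : ℝ) with hadef
  set η := q - 2 * m with hη
  have hη0 : 0 < η := by linarith
  have hSAle : SA ≤ 1 + z u := by linarith
  have hqy : q * z u ≤ (2 * (m : ℝ) + 2) * z u := mul_le_mul_of_nonneg_right (by linarith) hy0.le
  have hale : a ≤ (2 * (m : ℝ) + 2) * z u + 2 := by linarith
  -- The `m - a` core vertices not joined to `u` use up almost the whole budget `1 - η + z u`,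
  -- leaving only this much for `η` and `SA`.
  have hβ : ((m : ℝ) + 3) * (η + SA) ≤ 2 * (a + 3) := by
    have e1 : ((m : ℝ) + 3) * (η + SA) = ((m : ℝ) + 3) * (1 + z u) - ((m : ℝ) + 3) * SN := by
      rw [← mul_sub]; congr 1; linarith
    have e2 : ((R.filter fun o => ¬ G.Adj u o).card : ℝ) = m - a := by linarith
    rw [e2] at hnon
    nlinarith
  have hβ2 : m * (η + SA) ≤ m * (4 * z u) + 12 := by nlinarith
  have hβL : (η + SA) * L ≤ 1 / 30 := by
    have h1 : m * ((η + SA) * L) ≤ m * (1 / 30) := by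
      have : m * ((η + SA) * L) ≤ (m * (4 * z u) + 12) * L := by
        rw [← mul_assoc]; exact mul_le_mul_of_nonneg_right hβ2 (by linarith)
      have e1 : (m * (4 * z u) + 12) * L = 4 * (m * (z u * L)) + 12 * L := by ring
      have e2 : m * (z u * L) ≤ m * (1 / 250) := mul_le_mul_of_nonneg_left hyL2 (by linarith)
      linarith
    exact le_of_mul_le_mul_left h1 (by linarith)
  have hηL : η * L ≤ 1 / 30 := by
    have : 0 ≤ SA * L := mul_nonneg hA0 (by linarith)
    linarith
  have hSAsmall : SA ≤ 1 / 10 := by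
    have h1 : SA ≤ SA * L := le_mul_of_one_le_right hA0 (by linarith)
    have h2 : 0 ≤ η * L := mul_nonneg hη0.le (by linarith)
    linarith
  have hqyge : 19 / 10 ≤ q * z u := by linarith
  -- The growth factor is about `exp (2 η L)`, harmless because `η L ≤ 1/30`.
  have hgrow : pathGrowth q (r + 2) ≤ 10 / 9 * pathGrowth (2 * (m : ℝ)) (r + 2) := by
    have h1 := pathGrowth_le_pow_mul (by linarith : (5 : ℝ) ≤ 2 * m) hq.le (r + 2)
    refine h1.trans (mul_le_mul_of_nonneg_right ?_ (pathGrowth_pos (by linarith) _).le)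
    have hx0 : 0 ≤ 2 * η / (2 * m - 3) := div_nonneg (by linarith) (by linarith)
    have h2 : (1 + 2 * η / (2 * m - 3)) ^ (r + 2)
        ≤ Real.exp (((r + 2 : ℕ) : ℝ) * (2 * η / (2 * m - 3))) := by
      rw [Real.exp_nat_mul]
      refine pow_le_pow_left₀ (by linarith) ?_ _
      have := Real.add_one_le_exp (2 * η / (2 * m - 3))
      linarith
    have h3 : ((r + 2 : ℕ) : ℝ) * (2 * η / (2 * m - 3)) ≤ 1 / 10 := by
      push_cast
      rw [← hL, ← mul_div_assoc, div_le_iff₀ (by linarith)]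
      have e1 : L * (2 * ((m : ℝ) + 1)) * (2 * η) = 4 * ((m : ℝ) + 1) * (η * L) := by ring
      have e2 : 4 * ((m : ℝ) + 1) * (η * L) ≤ 4 * ((m : ℝ) + 1) * (1 / 30) :=
        mul_le_mul_of_nonneg_left hηL (by linarith)
      linarith
    have h4 : Real.exp (1 / 10) ≤ 10 / 9 := by
      have h5 := Real.add_one_le_exp (-(1 / 10) : ℝ)
      rw [Real.exp_neg] at h5
      have h6 := (le_inv_comm₀ (by norm_num) (Real.exp_pos _)).1 h5
      norm_num at h6 ⊢
      linarith
    exact h2.trans ((Real.exp_le_exp.2 h3).trans h4)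
  have hfin : (2 * (m : ℝ) - 3) * z u ≤ 10 / 9 := by
    have h1 := pathGrowth_step (by linarith : (4 : ℝ) ≤ 2 * m) (r + 2)
    have hz0 := h.pos (P 0)
    have h2 : (2 * (m : ℝ) - 3) * pathGrowth (2 * (m : ℝ)) (r + 2) * z (P 0) ≤ 1 :=
      (mul_le_mul_of_nonneg_right h1 hz0.le).trans hB
    have h3 : z u ≤ 10 / 9 * pathGrowth (2 * (m : ℝ)) (r + 2) * z (P 0) :=
      hsle.trans (mul_le_mul_of_nonneg_right hgrow hz0.le)
    have h4 : (2 * (m : ℝ) - 3) * z u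
        ≤ (2 * (m : ℝ) - 3) * (10 / 9 * pathGrowth (2 * (m : ℝ)) (r + 2) * z (P 0)) :=
      mul_le_mul_of_nonneg_left h3 (by linarith)
    linarith
  nlinarith

/-- A graph whose principal ratio is at least that of two suitable kites is itself a kite. -/
theorem eq_kiteAlong (h : GeodesicEigen G q z P lev (r + 3) m) (hy : ∀ v, 0 < y v)
    (hE : IsQEigen (kiteAlong P (r + 3)) q' y) (hq' : 2 * (m : ℝ) < q') (hm : 100 ≤ m)
    (hA : pathGrowth (2 * ((m : ℝ) + 1)) (r + 2) * z (P 0) ≤ 1)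
    (hB : pathGrowth q' (r + 3) * z (P 0) ≤ 1)
    (hL : L * (2 * ((m : ℝ) + 1)) = r + 2) (hL0 : 2000 ≤ L) (hLm : 1000 * L ≤ m) :
    G = kiteAlong P (r + 3) := by
  have hm' : (100 : ℝ) ≤ m := by exact_mod_cast hm
  have hle := h.le_value hm hq' hB
  have hq : 2 * (m : ℝ) < q := hq'.trans_le hle
  have hgate : gate G P r = {P (r + 2)} := by
    obtain ⟨u, hu⟩ := Finset.card_eq_one.1 (h.card_gate hq hm hA hL (by linarith))
    have := h.path_mem_gate hq
    rw [hu, Finset.mem_singleton] at this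
    rw [hu, this]
  have hB' : pathGrowth (2 * (m : ℝ)) (r + 3) * z (P 0) ≤ 1 :=
    (mul_le_mul_of_nonneg_right (pathGrowth_mono (by linarith) hq'.le _) (h.pos _).le).trans hB
  have hsub := h.le_kiteAlong hq hgate (h.not_adj_core hq hm hA hB' hL hL0 hLm hgate)
  rcases hsub.eq_or_lt with heq | hlt
  · exact heq
  · have := h.eigen.lt_of_lt h.pos hE hy hlt
    linarith

end GeodesicEigen

/-! ### From a maximizer to its geodesic and the competing kites. -/

section Maximizer

variable {V : Type*} [Fintype V] [DecidableEq V] {G : SimpleGraph V}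

theorem exists_geodesicEigen (hG : G.Connected) :
    ∃ (q : ℝ) (z : V → ℝ) (P : ℕ → V) (lev : V → ℕ) (l m : ℕ),
      GeodesicEigen G q z P lev l m ∧ principalRatio G = 1 / z (P 0) := by
  obtain ⟨z, a, b, hz, hz1, hb, -, hE, hr⟩ := exists_isQEigen_principalRatio hG
  obtain ⟨w, hw⟩ := hG.exists_walk_length_eq_dist a b
  have hadj : ∀ i < G.dist a b, G.Adj (w.getVert i) (w.getVert (i + 1)) := fun i hi =>
    w.adj_getVert_succ (hw.symm ▸ hi)
  have hlevadj : ∀ u v, G.Adj u v → G.dist a v ≤ G.dist a u + 1 := by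
    intro u v huv
    have h1 := hG.dist_triangle (u := a) (v := u) (w := v)
    rwa [SimpleGraph.dist_eq_one_iff_adj.2 huv] at h1
  have hup : ∀ i ≤ G.dist a b, G.dist a (w.getVert i) ≤ i := by
    intro i
    induction i with
    | zero => intro _; simp
    | succ i ih =>
      intro hi
      have := hlevadj _ _ (hadj i hi)
      have := ih (by omega)
      omega
  -- Counting back from `b`: a vertex of the walk too close to `a` would shorten the distance to
  -- `b`.
  have hdown : ∀ j ≤ G.dist a b, G.dist a b ≤ G.dist a (w.getVert (G.dist a b - j)) + j := by
    intro j
    induction j with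
    | zero => intro _; rw [Nat.sub_zero, ← hw, w.getVert_length, hw, Nat.add_zero]
    | succ j ih =>
      intro hj
      have h1 := ih (by omega)
      have h2 := hlevadj _ _ (hadj (G.dist a b - (j + 1)) (by omega))
      rw [show G.dist a b - (j + 1) + 1 = G.dist a b - j by omega] at h2
      omega
  have hlev : ∀ i ≤ G.dist a b, G.dist a (w.getVert i) = i := by
    intro i hi
    have h1 := hup i hi
    have h2 := hdown (G.dist a b - i) (by omega)
    rw [show G.dist a b - (G.dist a b - i) = i by omega] at h2
    omega
  have hcard : G.dist a b + 1 ≤ Fintype.card V := by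
    have h1 := Finset.card_le_univ ((Finset.range (G.dist a b + 1)).image w.getVert)
    rwa [Finset.card_image_of_injOn, Finset.card_range] at h1
    intro i hi j hj hij
    simp only [Finset.coe_range, Set.mem_Iio] at hi hj
    rw [← hlev i (by omega), ← hlev j (by omega), hij]
  refine ⟨_, z, w.getVert, G.dist a, G.dist a b, Fintype.card V - (G.dist a b + 1),
    ⟨by omega, hz, hz1, ?_, hE, hadj, hlev, hlevadj⟩, ?_⟩
  · rw [← hw, w.getVert_length, hb]
  · rw [hr, w.getVert_zero]

theorem MaximizesPrincipalRatio.exists_kite_value (hG : MaximizesPrincipalRatio G) {P : ℕ → V}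
    {l m : ℕ} (hinj : ∀ i ≤ l, ∀ j ≤ l, P i = P j → i = j)
    (hcard : Fintype.card V = l + 1 + m) (hl : 1 ≤ l) :
    ∃ (q : ℝ) (y : V → ℝ), (∀ v, 0 < y v) ∧ IsQEigen (kiteAlong P l) q y ∧ 2 * (m : ℝ) < q ∧
      pathGrowth q l ≤ principalRatio G := by
  obtain ⟨q, y, hy, hE, hq, hr⟩ := kiteAlong_spectral hinj hcard hl
  exact ⟨q, y, hy, hE, hq, hr.trans (hG.2 _ (kiteAlong_connected hinj))⟩

theorem GeodesicEigen.one_le_pow_mul {q : ℝ} {z : V → ℝ} {P : ℕ → V} {lev : V → ℕ} {l m : ℕ}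
    (h : GeodesicEigen G q z P lev l m) : 1 ≤ (2 * ((m : ℝ) + 1)) ^ l * z (P 0) := by
  rcases Nat.eq_zero_or_pos l with rfl | hl
  · rw [pow_zero, one_mul, h.top]
  · have hq0 : 0 ≤ q := by
      have h1 := h.adj (l - 1) (by omega)
      rw [show l - 1 + 1 = l by omega] at h1
      have h2 := h.eigen.add_le h.pos h1.symm
      rw [h.top] at h2
      have := h.pos (P (l - 1))
      linarith
    have h1 := h.eigen.le_pow h.pos hq0 h.adj l le_rfl
    rw [h.top] at h1
    exact h1.trans (mul_le_mul_of_nonneg_right (pow_le_pow_left₀ hq0 h.le_two_mul l) (h.pos _).le)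

/-- Both powers are crude bounds on either side of `1 / z (P 0)`: a kite of any shape from below,
growth at rate `q ≤ 2(m + 1)` from above. -/
theorem GeodesicEigen.pow_le_pow {n : ℕ} {G : SimpleGraph (Fin n)} {q : ℝ} {z : Fin n → ℝ}
    {P : ℕ → Fin n} {lev : Fin n → ℕ} {l m : ℕ} (h : GeodesicEigen G q z P lev l m)
    (hG : MaximizesPrincipalRatio G) (hr : principalRatio G = 1 / z (P 0)) {l' m' : ℕ}
    (hn : n = l' + 1 + m') (hl' : 1 ≤ l') (hm' : 2 ≤ m') :
    (2 * (m' : ℝ) - 3) ^ l' ≤ (2 * ((m : ℝ) + 1)) ^ l := by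
  have hm'' : (2 : ℝ) ≤ m' := by exact_mod_cast hm'
  have hn0 : 0 < n := by omega
  have hz0 := h.pos (P 0)
  obtain ⟨q', -, -, -, hq', hg⟩ := hG.exists_kite_value
    (P := fun i => if hi : i < n then (⟨i, hi⟩ : Fin n) else ⟨0, hn0⟩) (l := l') (m := m') (by
      intro i hi j hj hij
      simpa [show i < n by omega, show j < n by omega] using hij) (by simpa using hn) hl'
  rw [hr, le_div_iff₀ hz0] at hg
  have h1 := pow_le_pathGrowth (by linarith : 4 ≤ q') l'
  have h2 : (2 * (m' : ℝ) - 3) ^ l' ≤ (q' - 3) ^ l' :=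
    pow_le_pow_left₀ (by linarith) (by linarith) _
  have h3 := h.one_le_pow_mul
  have h4 := mul_le_mul_of_nonneg_right (h2.trans h1) hz0.le
  exact le_of_mul_le_mul_right (h4.trans (hg.trans h3)) hz0

theorem MaximizesPrincipalRatio.eq_kiteAlong {q L : ℝ} {z : V → ℝ} {P : ℕ → V} {lev : V → ℕ}
    {r m : ℕ} (hG : MaximizesPrincipalRatio G) (h : GeodesicEigen G q z P lev (r + 3) m)
    (hr : principalRatio G = 1 / z (P 0)) (hm : 100 ≤ m)
    (hL : L * (2 * ((m : ℝ) + 1)) = r + 2) (hL0 : 2000 ≤ L) (hLm : 1000 * L ≤ m) :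
    2 * (m : ℝ) < q ∧ G = kiteAlong P (r + 3) := by
  have hm' : (100 : ℝ) ≤ m := by exact_mod_cast hm
  have hz0 := h.pos (P 0)
  obtain ⟨q₁, -, -, -, hq₁, hA⟩ := hG.exists_kite_value (P := P) (l := r + 2) (m := m + 1)
    (fun i hi j hj => h.inj i (by omega) j (by omega)) (by rw [h.card]; omega) (by omega)
  obtain ⟨q₂, y, hy, hE, hq₂, hB⟩ := hG.exists_kite_value h.inj h.card (by omega)
  rw [hr, le_div_iff₀ hz0] at hA hB
  push_cast at hq₁
  have hA' := (mul_le_mul_of_nonneg_right (pathGrowth_mono (by linarith) hq₁.le _) hz0.le).trans hA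
  exact ⟨hq₂.trans_le (h.le_value hm hq₂ hB), h.eq_kiteAlong hy hE hq₂ hm hA' hB hL hL0 hLm⟩

end Maximizer

/-! ### Stability of the inequality `c - 1 ≤ log c`. -/

section Asymptotics

/-- The limiting inequality `c - 1 ≤ log c` holds only at `c = 1`. The tangents of `log` at `1 ± δ`
leave the gaps `g` and `k` there, and `ε` is chosen so that the perturbations cannot fill them. -/
theorem abs_sub_one_le_of_log_ineq {δ : ℝ} (hδ : 0 < δ) (hδ1 : δ < 1) :
    ∃ ε > 0, ∀ c ell lam e : ℝ, 0 < c → c ≤ ell → 1 ≤ ε * ell → |lam - 1| ≤ ε → e ≤ ε →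
      (c - 1) * lam - e ≤ (1 - c / ell) * Real.log c → |c - 1| ≤ δ := by
  have hg : 0 < δ - Real.log (1 + δ) := by
    have := Real.log_lt_sub_one_of_pos (by linarith : 0 < 1 + δ) (by linarith)
    linarith
  have hh : 0 < -Real.log (1 - δ) - δ := by
    have := Real.log_lt_sub_one_of_pos (by linarith : 0 < 1 - δ) (by linarith)
    linarith
  set g := δ - Real.log (1 + δ) with hgdef
  set k := -Real.log (1 - δ) - δ with hkdef
  refine ⟨min (g / 3) (min (δ / 2) (k / (4 + k))), by positivity, ?_⟩
  set ε := min (g / 3) (min (δ / 2) (k / (4 + k))) with hε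
  have hε0 : 0 < ε := by positivity
  have hε1 : ε ≤ g / 3 := min_le_left _ _
  have hε2 : ε ≤ δ / 2 := (min_le_right _ _).trans (min_le_left _ _)
  have hε3 : ε * (4 + k) ≤ k := by
    rw [← le_div_iff₀ (by linarith)]
    exact (min_le_right _ _).trans (min_le_right _ _)
  intro c ell lam e hc hcl hell hlam he hmain
  have hell0 : 0 < ell := hc.trans_le hcl
  obtain ⟨hlam1, hlam2⟩ := abs_le.1 hlam
  rw [abs_le]
  constructor
  · by_contra! hlt
    have hlog : Real.log c ≤ -k - (1 - c) := by
      have h1 := Real.log_le_sub_one_of_pos (div_pos hc (by linarith : 0 < 1 - δ))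
      rw [Real.log_div hc.ne' (by linarith)] at h1
      have h2 : c / (1 - δ) - 1 ≤ c - (1 - δ) := by
        rw [div_sub_one (by linarith), div_le_iff₀ (by linarith)]
        nlinarith
      linarith
    have hcoef : 1 - ε ≤ 1 - c / ell := by
      have : c / ell ≤ ε := by
        rw [div_le_iff₀ hell0]; linarith
      linarith
    have h3 : (1 - c / ell) * Real.log c ≤ (1 - ε) * Real.log c :=
      mul_le_mul_of_nonpos_right hcoef (by linarith)
    have h4 : (1 - ε) * Real.log c ≤ (1 - ε) * (-k - (1 - c)) :=
      mul_le_mul_of_nonneg_left hlog (by linarith)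
    have h5 : (1 - c) * lam ≤ (1 - c) * (1 + ε) :=
      mul_le_mul_of_nonneg_left (by linarith) (by linarith)
    have h6 : 0 ≤ c * ε := by positivity
    nlinarith
  · by_contra! hlt
    have hlog : Real.log c ≤ δ - g + (c - 1 - δ) / (1 + δ) := by
      have h1 := Real.log_le_sub_one_of_pos (div_pos hc (by linarith : 0 < 1 + δ))
      rw [Real.log_div hc.ne' (by linarith)] at h1
      have h2 : c / (1 + δ) - 1 = (c - 1 - δ) / (1 + δ) := by
        field_simp; ring
      linarith
    have hlog0 : 0 ≤ Real.log c := Real.log_nonneg (by linarith)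
    have h3 : (1 - c / ell) * Real.log c ≤ Real.log c := by
      have : 0 ≤ c / ell * Real.log c := by positivity
      linarith
    have h5 : (c - 1) * (1 - ε) ≤ (c - 1) * lam :=
      mul_le_mul_of_nonneg_left (by linarith) (by linarith)
    have h6 : (c - 1) * (1 - ε) - ε ≤ δ - g + (c - 1 - δ) / (1 + δ) := by linarith
    have h7 : (c - 1 - δ) / (1 + δ) ≤ (c - 1 - δ) * (1 - ε) := by
      rw [div_le_iff₀ (by linarith), mul_assoc]
      refine le_mul_of_one_le_right (by linarith) ?_
      nlinarith
    nlinarith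

end Asymptotics

/-! ### Size of the clique. -/

section Size

theorem tendsto_log_natCast : Tendsto (fun n : ℕ => Real.log (n : ℝ)) atTop atTop :=
  Real.tendsto_log_atTop.comp tendsto_natCast_atTop_atTop

theorem tendsto_log_log_div_log :
    Tendsto (fun n : ℕ => Real.log (Real.log n) / Real.log n) atTop (nhds 0) :=
  (Real.isLittleO_log_id_atTop.tendsto_div_nhds_zero).comp tendsto_log_natCast

theorem eventually_mul_log_sq_le (C : ℝ) (hC : 0 < C) :
    ∀ᶠ n : ℕ in atTop, C * Real.log (n : ℝ) ^ 2 ≤ n := by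
  have h := (Real.isLittleO_pow_log_id_atTop (n := 2)).comp_tendsto tendsto_natCast_atTop_atTop
  filter_upwards [h.bound (inv_pos.2 hC)] with n hn
  simp only [Function.comp, id, Real.norm_eq_abs, abs_of_nonneg (sq_nonneg (Real.log (n : ℝ))),
    Nat.abs_cast] at hn
  rwa [← div_eq_inv_mul, le_div_iff₀ hC, mul_comm] at hn

theorem eventually_abs_log_ratio_le {ε : ℝ} (hε : 0 < ε) :
    ∀ᶠ n : ℕ in atTop, |Real.log (2 * (n / Real.log n)) / Real.log n - 1| ≤ ε := by
  have h1 : Tendsto (fun n : ℕ => Real.log 2 / Real.log n - Real.log (Real.log n) / Real.log n)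
      atTop (nhds (0 - 0)) :=
    (tendsto_const_nhds.div_atTop tendsto_log_natCast).sub tendsto_log_log_div_log
  rw [sub_zero] at h1
  have h2 := (Metric.tendsto_nhds.1 h1) ε hε
  filter_upwards [h2, tendsto_log_natCast.eventually_ge_atTop 1, eventually_ge_atTop 1]
    with n hn hlog hn1
  have hn0 : (0 : ℝ) < n := by exact_mod_cast hn1
  have hl0 : 0 < Real.log (n : ℝ) := by linarith
  rw [dist_zero_right, Real.norm_eq_abs] at hn
  rw [Real.log_mul two_ne_zero (by positivity), Real.log_div hn0.ne' hl0.ne']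
  have : (Real.log 2 + (Real.log n - Real.log (Real.log n))) / Real.log n - 1
      = Real.log 2 / Real.log n - Real.log (Real.log n) / Real.log n := by
    field_simp; ring
  rw [this]; exact hn.le

theorem eventually_abs_sub_le {δ : ℝ} (hδ : 0 < δ) (hδ1 : δ < 1) :
    ∀ᶠ n : ℕ in atTop, ∀ l m : ℕ, n = l + 1 + m →
      (∀ l' m' : ℕ, n = l' + 1 + m' → 1 ≤ l' → 2 ≤ m' →
        (2 * (m' : ℝ) - 3) ^ l' ≤ (2 * ((m : ℝ) + 1)) ^ l) →
      |(m : ℝ) + 1 - n / Real.log n| ≤ δ * (n / Real.log n) := by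
  obtain ⟨ε, hε, key⟩ := abs_sub_one_le_of_log_ineq hδ hδ1
  filter_upwards [tendsto_log_natCast.eventually_ge_atTop 20,
    tendsto_log_natCast.eventually_ge_atTop (1 / ε), eventually_abs_log_ratio_le hε,
    eventually_mul_log_sq_le 100 (by norm_num), eventually_mul_log_sq_le (6 / ε) (by positivity)]
    with n hl20 hlε hlam hsq hsqε l m hn hpow
  set ell := Real.log (n : ℝ) with hell
  set T := (n : ℝ) / ell with hT
  have hell0 : 0 < ell := by linarith
  have hTell : T * ell = n := div_mul_cancel₀ _ hell0.ne'
  have hT100 : 100 * ell ≤ T := by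
    rw [hT, le_div_iff₀ hell0]; linarith
  have hT0 : 0 < T := by linarith
  have hn0 : (0 : ℝ) < n := by rw [← hTell]; positivity
  have hTn : 20 * T ≤ n := by rw [← hTell]; nlinarith
  have hM : (m : ℝ) + 1 = n - l := by rw [hn]; push_cast; ring
  have hM0 : (0 : ℝ) < (m : ℝ) + 1 := by positivity
  have hMn : (m : ℝ) + 1 ≤ n := by
    rw [hM]; have : (0 : ℝ) ≤ l := by positivity
    linarith
  set M := (m : ℝ) + 1 with hMdef
  have hfl1 : (⌊T⌋₊ : ℝ) ≤ T := Nat.floor_le hT0.le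
  have hfl2 : T < (⌊T⌋₊ : ℝ) + 1 := Nat.lt_floor_add_one T
  have hfln : ⌊T⌋₊ + 2 ≤ n := by
    have : (⌊T⌋₊ : ℝ) + 2 ≤ n := by linarith
    exact_mod_cast this
  have hfl3 : 2 ≤ ⌊T⌋₊ := Nat.le_floor (by push_cast; linarith)
  -- The test kite has about `T = n / log n` vertices off its path, the approximate maximizer of `(n
  -- - M) log (2M)`.
  have h1 := hpow (n - 1 - ⌊T⌋₊) ⌊T⌋₊ (by omega) (by omega) hfl3
  have hbase : 2 * T - 5 ≤ 2 * (⌊T⌋₊ : ℝ) - 3 := by linarith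
  have hlogpow := Real.log_le_log (pow_pos (by linarith) _) h1
  rw [Real.log_pow, Real.log_pow] at hlogpow
  have hl' : ((n - 1 - ⌊T⌋₊ : ℕ) : ℝ) = n - 1 - (⌊T⌋₊ : ℝ) := by
    rw [Nat.cast_sub (by omega), Nat.cast_sub (by omega), Nat.cast_one]
  rw [hl'] at hlogpow
  have hlogb : Real.log (2 * T) - 5 / T ≤ Real.log (2 * (⌊T⌋₊ : ℝ) - 3) := by
    refine le_trans ?_ (Real.log_le_log (by linarith) hbase)
    have h2 := Real.log_le_sub_one_of_pos (div_pos (by linarith : 0 < 2 * T)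
      (by linarith : 0 < 2 * T - 5))
    rw [Real.log_div (by linarith) (by linarith)] at h2
    have h3 : 2 * T / (2 * T - 5) - 1 = 5 / (2 * T - 5) := by
      rw [div_sub_one (by linarith)]; congr 1; ring
    have h4 : 5 / (2 * T - 5) ≤ 5 / T :=
      div_le_div_of_nonneg_left (by norm_num) hT0 (by linarith)
    linarith
  have h5T : 5 / T ≤ 1 := by rw [div_le_one hT0]; linarith
  have hlog2T : Real.log (2 * T) ≤ ell := Real.log_le_log (by linarith) (by linarith)
  have hlog2T1 : 1 ≤ Real.log (2 * T) := by
    rw [Real.le_log_iff_exp_le (by linarith)]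
    have := Real.exp_one_lt_d9
    linarith
  -- Of the error `6 * ell`, `5 * ell` pays for replacing the base by `2T` and one `ell` for the
  -- exponent `n - 1 - T` in place of `n - T`.
  have hlow : (n - T) * Real.log (2 * T) - 6 * ell
      ≤ (n - 1 - (⌊T⌋₊ : ℝ)) * Real.log (2 * (⌊T⌋₊ : ℝ) - 3) := by
    have h2 : (n - 1 - T) * (Real.log (2 * T) - 5 / T)
        ≤ (n - 1 - (⌊T⌋₊ : ℝ)) * Real.log (2 * (⌊T⌋₊ : ℝ) - 3) :=
      mul_le_mul (by linarith) hlogb (by linarith) (by linarith)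
    have h3 : (n - 1 - T) * (5 / T) ≤ 5 * ell := by
      have : n * (5 / T) = 5 * ell := by rw [← hTell]; field_simp
      have : 0 ≤ (1 + T) * (5 / T) := by positivity
      linarith
    linarith
  have hc0 : 0 < M / T := by positivity
  have hlogM : Real.log (2 * M) = Real.log (2 * T) + Real.log (M / T) := by
    rw [← Real.log_mul (by positivity) hc0.ne']
    congr 1; field_simp
  have hl : (l : ℝ) = n - M := by linarith
  rw [hl, hlogM] at hlogpow
  have hmain : (M - T) * Real.log (2 * T) - 6 * ell ≤ (n - M) * Real.log (M / T) := by linarith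
  have hres := key (M / T) ell (Real.log (2 * T) / ell) (6 * ell / n) hc0
    (by rw [div_le_iff₀ hT0, mul_comm, hTell]; exact hMn)
    (by rw [mul_comm, ← div_le_iff₀ hε]; exact hlε) hlam
    (by rw [div_le_iff₀ hn0]
        rw [div_mul_eq_mul_div, div_le_iff₀ hε] at hsqε
        nlinarith)
    (by
      have e1 : (M / T - 1) * (Real.log (2 * T) / ell) - 6 * ell / n
          = ((M - T) * Real.log (2 * T) - 6 * ell) / n := by
        rw [← hTell]; field_simp
      have e2 : (1 - M / T / ell) * Real.log (M / T) = (n - M) * Real.log (M / T) / n := by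
        rw [← hTell]; field_simp
      rw [e1, e2]
      exact div_le_div_of_nonneg_right hmain hn0.le)
  have : M - T = (M / T - 1) * T := by field_simp
  rw [this, abs_mul, abs_of_pos hT0]
  exact mul_le_mul_of_nonneg_right hres hT0.le

/-- Large maximizers are kites, with a clique of size asymptotic to `n / log n`. -/
theorem eventually_eq_kiteAlong {δ : ℝ} (hδ : 0 < δ) (hδ1 : δ ≤ 1 / 2) :
    ∀ᶠ n : ℕ in atTop, ∀ G : SimpleGraph (Fin n), MaximizesPrincipalRatio G →
      ∃ (q : ℝ) (z : Fin n → ℝ) (P : ℕ → Fin n) (lev : Fin n → ℕ) (r m : ℕ),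
        GeodesicEigen G q z P lev (r + 3) m ∧ 2 * (m : ℝ) < q ∧ G = kiteAlong P (r + 3) ∧
        |(m : ℝ) + 1 - n / Real.log n| ≤ δ * (n / Real.log n) := by
  filter_upwards [eventually_abs_sub_le hδ (by linarith),
    tendsto_log_natCast.eventually_ge_atTop 100000, eventually_mul_log_sq_le 10000 (by norm_num)]
    with n hsize hl hsq G hG
  obtain ⟨q, z, P, lev, l, m, h, hr⟩ := exists_geodesicEigen hG.1
  have hcard : n = l + 1 + m := by simpa using h.card
  have hM := hsize l m hcard fun l' m' hn hl' hm' => h.pow_le_pow hG hr hn hl' hm'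
  have hM' := hM
  rw [abs_le] at hM'
  obtain ⟨hM1, hM2⟩ := hM'
  set ell := Real.log (n : ℝ) with hell
  set T := (n : ℝ) / ell with hT
  have hell0 : 0 < ell := by linarith
  have hTell : T * ell = n := div_mul_cancel₀ _ hell0.ne'
  have hT1 : 10000 * ell ≤ T := by
    rw [hT, le_div_iff₀ hell0]; linarith
  have hTn : 100000 * T ≤ n := by rw [← hTell]; nlinarith
  have hδT : δ * T ≤ 1 / 2 * T := mul_le_mul_of_nonneg_right hδ1 (by linarith)
  have hnr : (n : ℝ) = l + 1 + m := by rw [hcard]; push_cast; ring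
  have hl3 : 3 ≤ l := by
    have : (3 : ℝ) ≤ l := by linarith
    exact_mod_cast this
  obtain ⟨r, rfl⟩ : ∃ r, l = r + 3 := ⟨l - 3, by omega⟩
  push_cast at hnr
  have hm100 : 100 ≤ m := by
    have : (100 : ℝ) ≤ m := by linarith
    exact_mod_cast this
  have hm0 : (0 : ℝ) < 2 * ((m : ℝ) + 1) := by positivity
  -- Since `m + 1` is within a factor of `n / log n`, this `L` has order `log n`: large, yet
  -- negligible against `m`.
  obtain ⟨hq, hGk⟩ := hG.eq_kiteAlong (L := ((r : ℝ) + 2) / (2 * ((m : ℝ) + 1))) h hr hm100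
    (div_mul_cancel₀ _ hm0.ne') (by rw [le_div_iff₀ hm0]; linarith) (by
      have : ((r : ℝ) + 2) / (2 * ((m : ℝ) + 1)) ≤ ell := by
        rw [div_le_iff₀ hm0]
        have : ell * T ≤ ell * (2 * ((m : ℝ) + 1)) :=
          mul_le_mul_of_nonneg_left (by linarith) hell0.le
        have hm1 : (0 : ℝ) ≤ m := by positivity
        linarith
      linarith)
  exact ⟨q, z, P, lev, r, m, h, hq, hGk, hM⟩

end Size

/-! ### Reading the clique size off an isomorphism with a kite. -/

section KiteCounting

open Classical in
theorem card_filter_kiteGraph_adj_le (r s : ℕ) (i : Fin (r + s - 1)) :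
    (Finset.univ.filter ((kiteGraph r s).Adj i)).card ≤ s + 2 := by
  have hsub : (Finset.univ.filter ((kiteGraph r s).Adj i)).image (fun j : Fin (r + s - 1) => (j : ℕ))
      ⊆ {(i : ℕ) - 1, (i : ℕ) + 1} ∪ Finset.Ico (r - 1) (r - 1 + s) := by
    intro a ha
    rw [Finset.mem_image] at ha
    obtain ⟨j, hj, rfl⟩ := ha
    have hj : ((i : ℕ) < r ∧ (j : ℕ) < r ∧ ((i : ℕ) + 1 = j ∨ (j : ℕ) + 1 = i)) ∨
      (i ≠ j ∧ r ≤ (i : ℕ) + 1 ∧ r ≤ (j : ℕ) + 1) := (Finset.mem_filter.1 hj).2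
    have := j.isLt
    simp only [Finset.mem_union, Finset.mem_insert, Finset.mem_singleton, Finset.mem_Ico]
    omega
  rw [← Finset.card_image_of_injective _ Fin.val_injective]
  refine (Finset.card_le_card hsub).trans ((Finset.card_union_le _ _).trans ?_)
  have := Finset.card_le_two (a := (i : ℕ) - 1) (b := (i : ℕ) + 1)
  rw [Nat.card_Ico]
  omega

/-- Compares the degree of `P l` with the degrees in the kite. With the clique bound below, it ties
a given kite's size to `m` up to a constant, so uniqueness of the kite parameter is not needed. -/
theorem GeodesicEigen.le_of_iso {V : Type*} [Fintype V] {G : SimpleGraph V} {q : ℝ} {z : V → ℝ}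
    {P : ℕ → V} {lev : V → ℕ} {l m r s : ℕ} (h : GeodesicEigen G q z P lev l m)
    (hq : 2 * (m : ℝ) < q) (e : G ≃g kiteGraph r s) : m + 1 ≤ s + 2 := by
  classical
  refine (h.succ_le_card hq).trans (le_trans ?_ (card_filter_kiteGraph_adj_le r s (e (P l))))
  refine Finset.card_le_card_of_injOn e (fun u hu => ?_) e.injective.injOn
  have hu : G.Adj (P l) u := by simpa using hu
  simpa using e.map_adj_iff.2 hu

theorem IsQEigen.le_of_iso {V : Type*} [Fintype V] {G : SimpleGraph V} {q : ℝ} {z : V → ℝ}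
    {r s : ℕ} (h : IsQEigen G q z) (hz : ∀ v, 0 < z v) (hr : 1 ≤ r)
    (e : G ≃g kiteGraph r (s + 1)) : 2 * (s : ℝ) ≤ q := by
  classical
  have hlt : ∀ i : Fin (s + 1), r - 1 + (i : ℕ) < r + (s + 1) - 1 := fun i => by omega
  have hinj : Function.Injective fun i : Fin (s + 1) => e.symm ⟨r - 1 + i, hlt i⟩ := by
    intro i j hij
    have := e.symm.injective hij
    rw [Fin.mk.injEq] at this
    exact Fin.ext (by omega)
  refine h.clique_le hz (S := Finset.univ.image fun i : Fin (s + 1) => e.symm ⟨r - 1 + i, hlt i⟩)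
    (by rw [Finset.card_image_of_injective _ hinj, Finset.card_univ, Fintype.card_fin]) ?_
  intro u hu v hv huv
  rw [Finset.mem_image] at hu hv
  obtain ⟨i, -, rfl⟩ := hu
  obtain ⟨j, -, rfl⟩ := hv
  refine e.symm.map_adj_iff.2 (Or.inr ⟨fun hc => huv (by rw [hc]), ?_, ?_⟩)
  · simp only []; omega
  · simp only []; omega

end KiteCounting

theorem theorem1 :
    (∃ N : ℕ, ∀ n : ℕ, N ≤ n → ∀ G : SimpleGraph (Fin n), MaximizesPrincipalRatio G →
      ∃ k : ℕ, 1 ≤ k ∧ k ≤ n ∧ Nonempty (G ≃g kiteGraph k (n - k + 1))) ∧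
    (∀ (G : (n : ℕ) → SimpleGraph (Fin n)) (k : ℕ → ℕ),
      (∀ᶠ n : ℕ in atTop, MaximizesPrincipalRatio (G n) ∧ 1 ≤ k n ∧ k n ≤ n ∧
        Nonempty (G n ≃g kiteGraph (k n) (n - k n + 1))) →
      (fun n : ℕ => (n : ℝ) - (k n : ℝ)) ~[atTop] (fun n : ℕ => (n : ℝ) / Real.log (n : ℝ))) := by
  constructor
  · obtain ⟨N, hN⟩ := eventually_atTop.1
      (eventually_eq_kiteAlong (δ := 1 / 2) (by norm_num) le_rfl)
    refine ⟨N, fun n hn G hG => ?_⟩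
    obtain ⟨q, z, P, lev, r, m, h, -, hGk, -⟩ := hN n hn G hG
    have hcard : n = r + 3 + 1 + m := by simpa using h.card
    refine ⟨r + 3 + 1, by omega, by omega, ?_⟩
    rw [hGk]
    exact kiteAlong_iso h.inj (by rw [Fintype.card_fin]; omega)
  · intro G k hGk
    rw [IsEquivalent, isLittleO_iff]
    intro c hc
    -- Half of `c` covers the error in `m + 1`; the other half covers the discrepancy of at most 3
    -- between `m + 1` and `n - k n`, once `n / log n ≥ 6 / c`.
    have hδ : 0 < min (c / 2) (1 / 2) := by positivity
    filter_upwards [hGk, eventually_eq_kiteAlong hδ (min_le_right _ _),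
      tendsto_log_natCast.eventually_ge_atTop 1, tendsto_log_natCast.eventually_ge_atTop (6 / c),
      eventually_mul_log_sq_le 1 one_pos] with n ⟨hG, hk1, hkn, ⟨e⟩⟩ hn hl1 hlc hsq
    obtain ⟨q, z, P, lev, r, m, h, hq, -, hM⟩ := hn (G n) hG
    have h1 := h.le_of_iso hq e
    have h2 := (h.eigen.le_of_iso h.pos hk1 e).trans h.le_two_mul
    rw [Nat.cast_sub hkn] at h2
    have h3 : (m : ℝ) ≤ n - k n + 2 := by
      rw [← Nat.cast_sub hkn]
      exact_mod_cast (by omega : m ≤ n - k n + 2)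
    rw [abs_le] at hM
    have hT : 6 / c ≤ (n : ℝ) / Real.log n := by
      refine hlc.trans ?_
      rw [le_div_iff₀ (by linarith)]; linarith
    rw [div_le_iff₀ hc] at hT
    have hT0 : 0 ≤ (n : ℝ) / Real.log n := div_nonneg (Nat.cast_nonneg n) (by linarith)
    have hδT : min (c / 2) (1 / 2) * ((n : ℝ) / Real.log n) ≤ c / 2 * ((n : ℝ) / Real.log n) :=
      mul_le_mul_of_nonneg_right (min_le_left _ _) hT0
    rw [Pi.sub_apply, Real.norm_eq_abs, Real.norm_eq_abs, abs_of_nonneg hT0, abs_le]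
    constructor <;> linarith [hM.1, hM.2]
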